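/- Let $M$ be a smooth manifold of dimension $n$ with a transversely holomorphic foliation $\mathcal F$ of complex codimension $r$: there are an open cover $(U_i)$ of $M$, a complex manifold $T$ of dimension $r$, smooth submersions $f_i:U_i\to T$ with connected fibres (the plaques of $\mathcal F$), and biholomorphisms $\gamma_{ij}$ between open subsets of $T$ with $f_j=\gamma_{ij}\circ f_i$ on $U_i\cap U_j$. A smooth complex-valued form $\alpha$ on $M$ is basic if $i_X\alpha=i_Xd\alpha=0$ for all $X$ tangent to the leaves. The complex structure which the $f_i$ induce on the normal bundle of $\mathcal F$ decomposes the space $\Omega^k(M/\mathcal F,\mathbb C)$ of basic $k$-forms as $\bigoplus_{p+q=k}\Omega^{p,q}(M/\mathcal F,\mathbb C)$, and $d=\partial+\bar\partial$ on basic forms with $\partial,\bar\partial$ of bidegree $(1,0)$ and $(0,1)$. Let $H^k(M/\mathcal F,\mathbb C)=\ker d/\operatorname{im}d$ be the basic cohomology and let $$H^{\bullet,\bullet}_{\bar\partial}(M/\mathcal F)=\frac{\ker\bar\partial}{\operatorname{im}\bar\partial},\qquad H^{\bullet,\bullet}_{BC}(M/\mathcal F)=\frac{\ker\partial\cap\ker\bar\partial}{\operatorname{im}\partial\bar\partial},\qquad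 H^{\bullet,\bullet}_{A}(M/\mathcal F)=\frac{\ker\partial\bar\partial}{\operatorname{im}\partial+\operatorname{im}\bar\partial}$$ be the basic Dolbeault, Bott–Chern and Aeppli cohomologies. Assume that $H^{p,q}_{\bar\partial}(M/\mathcal F)$ is finite-dimensional for all $p,q$. Then for every $k\in\mathbb N$ $$\sum_{p+q=k}\bigl(\dim_{\mathbb C}H^{p,q}_{BC}(M/\mathcal F)+\dim_{\mathbb C}H^{p,q}_{A}(M/\mathcal F)\bigr)\ \ge\ 2\dim_{\mathbb C}H^k(M/\mathcal F,\mathbb C).$$ Moreover, equality holds for every $k\in\mathbb N$ if and only if $\mathcal F$ satisfies the $\partial\bar\partial$-lemma, that is, $\ker\partial\cap\ker\bar\partial\cap\operatorname{im}d=\operatorname{im}\partial\bar\partial$ in $\Omega^{\bullet}(M/\mathcal F,\mathbb C)$. -/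

import Mathlib

open scoped Manifold ContDiff Topology

noncomputable section

namespace BasicForms

section NormedSpaces
variable {E F : Type*} [NormedAddCommGroup E] [NormedSpace ℝ E]
  [NormedAddCommGroup F] [NormedSpace ℝ F] {k : ℕ}

lemma exists_leftInverse_toMultilinear (E : Type*) [NormedAddCommGroup E] [NormedSpace ℝ E]
    [FiniteDimensional ℝ E] (k : ℕ) :
    ∃ L : ContinuousMultilinearMap ℝ (fun _ : Fin k => E) ℂ →L[ℝ] (E [⋀^Fin k]→L[ℝ] ℂ),
      ∀ a : E [⋀^Fin k]→L[ℝ] ℂ, L a.toContinuousMultilinearMap = a := by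
  have : FiniteDimensional ℝ (ContinuousMultilinearMap ℝ (fun _ : Fin k => E) ℂ) :=
    FiniteDimensional.of_injective
      (ContinuousMultilinearMap.toMultilinearMapLinear :
        ContinuousMultilinearMap ℝ (fun _ : Fin k => E) ℂ →ₗ[ℝ] _)
      ContinuousMultilinearMap.toMultilinearMap_injective
  obtain ⟨L, hL⟩ := LinearMap.exists_leftInverse_of_injective
    (ContinuousAlternatingMap.toContinuousMultilinearMapCLM ℝ :
      (E [⋀^Fin k]→L[ℝ] ℂ) →L[ℝ] _).toLinearMap
    (LinearMap.ker_eq_bot.2 ContinuousAlternatingMap.toContinuousMultilinearMap_injective)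
  exact ⟨LinearMap.toContinuousLinearMap L, fun a => LinearMap.congr_fun hL a⟩

lemma contDiffOn_pullback [FiniteDimensional ℝ E] {G : Type*} [NormedAddCommGroup G]
    [NormedSpace ℝ G] {b : G → F [⋀^Fin k]→L[ℝ] ℂ} {L : G → E →L[ℝ] F} {s : Set G}
    {r : WithTop ℕ∞} (hb : ContDiffOn ℝ r b s) (hL : ContDiffOn ℝ r L s) :
    ContDiffOn ℝ r (fun y => (b y).compContinuousLinearMap (L y)) s := by
  obtain ⟨A, hA⟩ := exists_leftInverse_toMultilinear E k
  have h1 : ContDiffOn ℝ r (fun y =>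
      (ContinuousMultilinearMap.compContinuousLinearMapContinuousMultilinear ℝ
        (fun _ : Fin k => E) (fun _ => F) ℂ (fun _ => L y))
        (ContinuousAlternatingMap.toContinuousMultilinearMapCLM ℝ (b y))) s := by
    refine ContDiffOn.clm_apply ?_ ?_
    · exact (ContinuousMultilinearMap.contDiff _).comp_contDiffOn
        (contDiffOn_pi.2 fun _ => hL)
    · exact (ContinuousLinearMap.contDiff _).comp_contDiffOn hb
  refine (A.contDiff.comp_contDiffOn h1).congr fun y hy => ?_
  exact (hA _).symm

lemma minSmoothness_two_le : minSmoothness ℝ 2 ≤ (∞ : WithTop ℕ∞) := by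
  rw [minSmoothness_of_isRCLikeNormedField]
  exact WithTop.coe_le_coe.2 (le_top : (2 : ℕ∞) ≤ ⊤)

lemma alternating_congr {V W : Type*} [AddCommGroup V] [Module ℝ V] [TopologicalSpace V]
    [AddCommGroup W] [Module ℝ W] (a : V [⋀^Fin k]→L[ℝ] ℂ) (l : V →ₗ[ℝ] W)
    (h : ∀ v : Fin k → V, (∃ j, l (v j) = 0) → a v = 0) (v w : Fin k → V)
    (hvw : ∀ j, l (v j) = l (w j)) : a v = a w := by
  classical
  have key : ∀ s : Finset (Fin k), a (s.piecewise v w) = a w := by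
    intro s
    induction s using Finset.induction_on with
    | empty => simp
    | insert i s hi ih =>
      rw [Finset.piecewise_insert, ← ih]
      have h1 : a (Function.update (s.piecewise v w) i (v i - w i)) = 0 := by
        refine h _ ⟨i, ?_⟩
        simp [hvw i]
      have h2 := a.map_update_add (s.piecewise v w) i (v i - w i) (w i)
      rw [h1, zero_add, sub_add_cancel] at h2
      rw [h2]
      congr 1
      ext j
      by_cases hj : j = i
      · subst hj; simp [hi]
      · simp [hj]
  simpa using key Finset.univ

lemma exists_local_descent [FiniteDimensional ℝ E] [FiniteDimensional ℝ F] {g : E → F}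
    {a : E → E [⋀^Fin k]→L[ℝ] ℂ} {W : Set E} (hW : IsOpen W) {y₀ : E} (hy₀ : y₀ ∈ W)
    (hg : ContDiffOn ℝ ∞ g W) (hs : ∀ y ∈ W, Function.Surjective (fderiv ℝ g y))
    (ha : ContDiffOn ℝ ∞ a W)
    (h0 : ∀ y ∈ W, ∀ v : Fin k → E, (∃ j, fderiv ℝ g y (v j) = 0) → a y v = 0)
    (h1 : ∀ y ∈ W, ∀ v : Fin (k + 1) → E, (∃ j, fderiv ℝ g y (v j) = 0) → extDeriv a y v = 0) :
    ∃ (b : F → F [⋀^Fin k]→L[ℝ] ℂ) (V : Set F) (W' : Set E), IsOpen V ∧ IsOpen W' ∧ y₀ ∈ W' ∧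
      W' ⊆ W ∧ Set.MapsTo g W' V ∧ ContDiffOn ℝ ∞ b V ∧
      ∀ y ∈ W', a y = (b (g y)).compContinuousLinearMap (fderiv ℝ g y) := by
  let K : Submodule ℝ E := (fderiv ℝ g y₀).ker
  obtain ⟨P, hP⟩ : ∃ P : E →L[ℝ] K, ∀ u : K, P u = u :=
    Submodule.ClosedComplemented.of_finiteDimensional_quotient
      (ContinuousLinearMap.isClosed_ker (fderiv ℝ g y₀))
  have hn : (∞ : WithTop ℕ∞) ≠ 0 := by simp
  let G : E → F × K := fun y => (g y, P y)
  have hGc : ContDiffOn ℝ ∞ G W := hg.prodMk P.contDiff.contDiffOn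
  have hgd : ∀ y ∈ W, HasFDerivAt g (fderiv ℝ g y) y := fun y hy =>
    ((hg.contDiffAt (hW.mem_nhds hy)).differentiableAt hn).hasFDerivAt
  have hGd : ∀ y ∈ W, HasFDerivAt G ((fderiv ℝ g y).prod P) y := fun y hy =>
    (hgd y hy).prodMk P.hasFDerivAt
  have hbij : Function.Bijective ((fderiv ℝ g y₀).prod P) := by
    constructor
    · refine (injective_iff_map_eq_zero _).2 fun v hv => ?_
      have hv' := Prod.ext_iff.1 hv
      have h3 : v ∈ K := hv'.1
      have h4 := hP ⟨v, h3⟩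
      have h5 : P v = 0 := hv'.2
      rw [h5] at h4
      exact (congrArg Subtype.val h4).symm
    · rintro ⟨t, u⟩
      obtain ⟨v, hv⟩ := hs y₀ hy₀ t
      refine ⟨v + ((u : E) - (P v : E)), Prod.ext ?_ ?_⟩
      · have e1 : fderiv ℝ g y₀ (u : E) = 0 := u.2
        have e2 : fderiv ℝ g y₀ (P v : E) = 0 := (P v).2
        simp [hv, e1, e2]
      · simp [hP]
  let e₀ : E ≃L[ℝ] F × K :=
    (LinearEquiv.ofBijective ((fderiv ℝ g y₀).prod P).toLinearMap hbij).toContinuousLinearEquiv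
  have he₀ : HasFDerivAt G (e₀ : E →L[ℝ] F × K) y₀ := by
    have : (e₀ : E →L[ℝ] F × K) = (fderiv ℝ g y₀).prod P := by ext v <;> rfl
    rw [this]
    exact hGd y₀ hy₀
  have hGc₀ : ContDiffAt ℝ ∞ G y₀ := hGc.contDiffAt (hW.mem_nhds hy₀)
  let φ := hGc₀.toOpenPartialHomeomorph G he₀ hn
  have hφ : ∀ y, φ y = G y := fun y => rfl
  have hφ0 : y₀ ∈ φ.source := hGc₀.mem_toOpenPartialHomeomorph_source he₀ hn
  have hcont : ContinuousOn (fun y => (fderiv ℝ g y).prod P) W := by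
    have h2 : ContinuousOn (fderiv ℝ G) W := hGc.continuousOn_fderiv_of_isOpen hW (by simp)
    exact h2.congr fun y hy => (hGd y hy).fderiv.symm
  let W₁ : Set E := (W ∩ (fun y => (fderiv ℝ g y).prod P) ⁻¹'
    (Set.range ((↑) : (E ≃L[ℝ] F × K) → E →L[ℝ] F × K))) ∩ φ.source
  have hW₁ : IsOpen W₁ :=
    (hcont.isOpen_inter_preimage hW ContinuousLinearEquiv.isOpen).inter φ.open_source
  have hy₁ : y₀ ∈ W₁ := ⟨⟨hy₀, e₀, by ext v <;> rfl⟩, hφ0⟩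
  have hW₁W : W₁ ⊆ W := fun y hy => hy.1.1
  have hopen : IsOpen (φ '' W₁) := φ.isOpen_image_of_subset_source hW₁ fun y hy => hy.2
  obtain ⟨ε, hε, hball⟩ := Metric.isOpen_iff.1 hopen (φ y₀) ⟨y₀, hy₁, rfl⟩
  set V : Set F := Metric.ball (g y₀) ε with hV
  set B : Set K := Metric.ball (P y₀) ε with hB
  have hVB : ∀ z : F × K, z.1 ∈ V → z.2 ∈ B → z ∈ φ '' W₁ := fun z hz1 hz2 => by
    apply hball
    have : z ∈ V ×ˢ B := ⟨hz1, hz2⟩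
    rw [hV, hB, ball_prod_same] at this
    exact this
  let O : Set (F × K) := V ×ˢ B
  have hO : IsOpen O := Metric.isOpen_ball.prod Metric.isOpen_ball
  let Ψ : F × K → E := φ.symm
  have hΨW : ∀ z ∈ O, Ψ z ∈ W₁ := by
    rintro z ⟨hz1, hz2⟩
    obtain ⟨y, hy, rfl⟩ := hVB z hz1 hz2
    change φ.symm (φ y) ∈ W₁
    rwa [φ.left_inv hy.2]
  have hGΨ : ∀ z ∈ O, G (Ψ z) = z := by
    rintro z ⟨hz1, hz2⟩
    obtain ⟨y, hy, rfl⟩ := hVB z hz1 hz2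
    exact φ.right_inv (φ.map_source hy.2)
  have hΨc : ∀ z ∈ O, ContDiffAt ℝ ∞ Ψ z := by
    intro z hz
    have hz' := hΨW z hz
    obtain ⟨e, he⟩ := hz'.1.2
    obtain ⟨y, hy, hyz⟩ := hVB z hz.1 hz.2
    refine φ.contDiffAt_symm (f₀' := e) (hyz ▸ φ.map_source hy.2) ?_ ?_
    · rw [he]
      exact hGd _ (hW₁W hz')
    · exact hGc.contDiffAt (hW.mem_nhds (hW₁W hz'))
  have hΨd : ∀ z ∈ O, HasFDerivAt Ψ (fderiv ℝ Ψ z) z := fun z hz =>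
    ((hΨc z hz).differentiableAt hn).hasFDerivAt
  have hcomp : ∀ z ∈ O, ∀ w : F × K,
      fderiv ℝ g (Ψ z) (fderiv ℝ Ψ z w) = w.1 ∧ P (fderiv ℝ Ψ z w) = w.2 := by
    intro z hz w
    have h2 := (hGd _ (hW₁W (hΨW z hz))).comp z (hΨd z hz)
    have h3 : HasFDerivAt (G ∘ Ψ) (ContinuousLinearMap.id ℝ (F × K)) z :=
      (hasFDerivAt_id z).congr_of_eventuallyEq
        (Filter.eventuallyEq_of_mem (hO.mem_nhds hz) hGΨ)
    have h4 := DFunLike.congr_fun (h2.unique h3) w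
    exact Prod.ext_iff.1 h4
  let a' : F × K → (F × K) [⋀^Fin k]→L[ℝ] ℂ := fun z =>
    (a (Ψ z)).compContinuousLinearMap (fderiv ℝ Ψ z)
  have hΨon : ContDiffOn ℝ ∞ Ψ O := fun z hz => (hΨc z hz).contDiffWithinAt
  have ha' : ContDiffOn ℝ ∞ a' O := by
    refine contDiffOn_pullback (ha.comp hΨon fun z hz => hW₁W (hΨW z hz)) ?_
    exact hΨon.fderiv_of_isOpen hO (by simp)
  have hvert0 : ∀ z ∈ O, ∀ v : Fin k → F × K, (∃ j, (v j).1 = 0) → a' z v = 0 := by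
    rintro z hz v ⟨j, hj⟩
    refine h0 _ (hW₁W (hΨW z hz)) _ ⟨j, ?_⟩
    exact (hcomp z hz (v j)).1.trans hj
  have hvert1 : ∀ z ∈ O, ∀ v : Fin (k + 1) → F × K, (∃ j, (v j).1 = 0) →
      extDeriv a' z v = 0 := by
    rintro z hz v ⟨j, hj⟩
    have h2 : extDeriv a' z = (extDeriv a (Ψ z)).compContinuousLinearMap (fderiv ℝ Ψ z) :=
      extDeriv_pullback (r := ∞)
        ((ha.contDiffAt (hW.mem_nhds (hW₁W (hΨW z hz)))).differentiableAt hn) (hΨc z hz)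
        minSmoothness_two_le
    rw [h2]
    refine h1 _ (hW₁W (hΨW z hz)) _ ⟨j, ?_⟩
    exact (hcomp z hz (v j)).1.trans hj
  have ha'd : ∀ z ∈ O, DifferentiableAt ℝ a' z := fun z hz =>
    (ha'.contDiffAt (hO.mem_nhds hz)).differentiableAt hn
  have hd : ∀ z ∈ O, ∀ (w : Fin k → F × K) (u : K),
      fderiv ℝ (fun z => a' z w) z (0, u) = 0 := by
    intro z hz w u
    have h2 := extDeriv_apply (ha'd z hz) (Fin.cons (0, u) w)
    rw [hvert1 z hz _ ⟨0, rfl⟩, Fin.sum_univ_succ] at h2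
    have h3 : ∀ i : Fin k, fderiv ℝ (fun z => a' z (i.succ.removeNth
        (Fin.cons ((0, u) : F × K) w : Fin (k + 1) → F × K))) z = 0 := by
      intro i
      have h4 : (fun z => a' z (i.succ.removeNth
          (Fin.cons ((0, u) : F × K) w : Fin (k + 1) → F × K))) =ᶠ[𝓝 z] fun _ => 0 := by
        refine Filter.eventuallyEq_of_mem (hO.mem_nhds hz) fun z' hz' => ?_
        refine hvert0 z' hz' _ ?_
        obtain ⟨m, rfl⟩ : ∃ m, k = m + 1 := ⟨k - 1, by have := i.2; omega⟩
        exact ⟨0, by simp [Fin.removeNth]⟩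
      rw [h4.fderiv_eq]
      simp
    simp only [h3] at h2
    simpa using h2.symm
  have hconst : ∀ z ∈ O, ∀ w : Fin k → F × K, a' z w = a' (z.1, P y₀) w := by
    intro z hz w
    have hin : ∀ u ∈ B, ((z.1, u) : F × K) ∈ O := fun u hu => ⟨hz.1, hu⟩
    have hdiff : ∀ u ∈ B, HasFDerivAt (fun u => a' (z.1, u) w)
        ((fderiv ℝ (fun z => a' z w) (z.1, u)).comp (ContinuousLinearMap.inr ℝ F K)) u := by
      intro u hu
      have h2 : DifferentiableAt ℝ (fun z => a' z w) (z.1, u) :=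
        (ha'd _ (hin u hu)).continuousAlternatingMap_apply_const w
      exact h2.hasFDerivAt.comp u (hasFDerivAt_prodMk_right z.1 u)
    have := Metric.isOpen_ball.is_const_of_fderiv_eq_zero (𝕜 := ℝ) (s := B)
      (f := fun u => a' (z.1, u) w) (convex_ball _ _).isPreconnected
      (fun u hu => (hdiff u hu).differentiableAt.differentiableWithinAt)
      (fun u hu => by
        rw [(hdiff u hu).fderiv]
        ext u'
        exact hd _ (hin u hu) w u') hz.2 (Metric.mem_ball_self hε)
    exact this
  refine ⟨fun t => (a' (t, P y₀)).compContinuousLinearMap (ContinuousLinearMap.inl ℝ F K), V,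
    W₁ ∩ φ ⁻¹' O, Metric.isOpen_ball, ?_, ⟨hy₁, Metric.mem_ball_self hε, Metric.mem_ball_self hε⟩,
    fun y hy => hW₁W hy.1, fun y hy => hy.2.1, ?_, ?_⟩
  · have hc : ContinuousOn φ W₁ := hGc.continuousOn.mono hW₁W
    exact hc.isOpen_inter_preimage hW₁ hO
  · refine contDiffOn_pullback ?_ contDiffOn_const
    refine ha'.comp (contDiff_id.prodMk contDiff_const).contDiffOn fun t ht => ?_
    exact ⟨ht, Metric.mem_ball_self hε⟩
  · rintro y ⟨hy, hyO⟩
    have hΨy : Ψ (G y) = y := φ.left_inv hy.2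
    have hyO' : G y ∈ O := hyO
    ext v
    have h2 := hconst (G y) hyO' (fun j => (fderiv ℝ g y (v j), 0))
    change a y v = a' ((G y).1, P y₀) (fun j => (fderiv ℝ g y (v j), 0))
    rw [← h2]
    change a y v = a (Ψ (G y)) (fun j => fderiv ℝ Ψ (G y) (fderiv ℝ g y (v j), 0))
    have h3 := fun j => (hcomp (G y) hyO' (fderiv ℝ g y (v j), 0)).1
    rw [hΨy] at h3 ⊢
    exact alternating_congr (a y) (fderiv ℝ g y).toLinearMap (h0 y (hW₁W hy)) _ _
      fun j => (h3 j).symm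
end NormedSpaces

section Manifolds
variable {E : Type*} [NormedAddCommGroup E] [NormedSpace ℝ E]
  {M : Type*} [TopologicalSpace M] [ChartedSpace E M] {k : ℕ}

/-- A (not necessarily smooth) complex valued `k`-form on the manifold `M` modelled on `E`. -/
def RawForm (E : Type*) [NormedAddCommGroup E] [NormedSpace ℝ E] (M : Type*)
    [TopologicalSpace M] [ChartedSpace E M] (k : ℕ) : Type _ :=
  (x : M) → TangentSpace 𝓘(ℝ, E) x [⋀^Fin k]→L[ℝ] ℂ

instance : AddCommGroup (RawForm E M k) := Pi.addCommGroup

instance : Module ℂ (RawForm E M k) :=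
  inferInstanceAs (Module ℂ ((x : M) → TangentSpace 𝓘(ℝ, E) x [⋀^Fin k]→L[ℝ] ℂ))

/-- The expression of a form in the preferred chart at `x₀`: the pullback of the form by the
inverse of the chart. -/
def chartRep (x₀ : M) (α : RawForm E M k) (y : E) : E [⋀^Fin k]→L[ℝ] ℂ :=
  ContinuousAlternatingMap.compContinuousLinearMap
    (M := TangentSpace 𝓘(ℝ, E) ((extChartAt 𝓘(ℝ, E) x₀).symm y))
    (α ((extChartAt 𝓘(ℝ, E) x₀).symm y))
    (mfderiv 𝓘(ℝ, E) 𝓘(ℝ, E) (extChartAt 𝓘(ℝ, E) x₀).symm y)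

/-- A form is smooth if its expressions in all charts are. -/
def IsSmooth (α : RawForm E M k) : Prop :=
  ∀ x₀ : M, ContDiffOn ℝ ∞ (chartRep x₀ α) (extChartAt 𝓘(ℝ, E) x₀).target

/-- The exterior derivative, computed at each point in the preferred chart at this point. -/
def extDerivForm (α : RawForm E M k) : RawForm E M (k + 1) := fun x =>
  ContinuousAlternatingMap.compContinuousLinearMap (M' := TangentSpace 𝓘(ℝ, E) x)
   (extDeriv (chartRep x α) (extChartAt 𝓘(ℝ, E) x x))
    (mfderiv 𝓘(ℝ, E) 𝓘(ℝ, E) (extChartAt 𝓘(ℝ, E) x) x)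

section
variable [IsManifold 𝓘(ℝ, E) ∞ M]

lemma mdiff_symm {x₀ : M} {y : E} (hy : y ∈ (extChartAt 𝓘(ℝ, E) x₀).target) :
    MDifferentiableAt 𝓘(ℝ, E) 𝓘(ℝ, E) (extChartAt 𝓘(ℝ, E) x₀).symm y :=
  ((contMDiffOn_extChartAt_symm (n := ∞) x₀).contMDiffAt
    ((isOpen_extChartAt_target x₀).mem_nhds hy)).mdifferentiableAt (by simp)

lemma mdiff_chart {x₀ x : M} (hx : x ∈ (extChartAt 𝓘(ℝ, E) x₀).source) :
    MDifferentiableAt 𝓘(ℝ, E) 𝓘(ℝ, E) (extChartAt 𝓘(ℝ, E) x₀) x :=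
  ((contMDiffOn_extChartAt (n := ∞)).contMDiffAt
    ((chartAt E x₀).open_source.mem_nhds (by simpa using hx))).mdifferentiableAt (by simp)

lemma contDiffAt_transition {x₀ x₁ : M} {y : E} (hy : y ∈ (extChartAt 𝓘(ℝ, E) x₀).target)
    (hy' : (extChartAt 𝓘(ℝ, E) x₀).symm y ∈ (extChartAt 𝓘(ℝ, E) x₁).source) :
    ContDiffAt ℝ ∞ (extChartAt 𝓘(ℝ, E) x₁ ∘ (extChartAt 𝓘(ℝ, E) x₀).symm) y := by
  rw [← contMDiffAt_iff_contDiffAt]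
  refine ContMDiffAt.comp y ?_ ((contMDiffOn_extChartAt_symm (n := ∞) x₀).contMDiffAt
    ((isOpen_extChartAt_target x₀).mem_nhds hy))
  exact (contMDiffOn_extChartAt (n := ∞)).contMDiffAt
    ((chartAt E x₁).open_source.mem_nhds (by simpa using hy'))

/-- Change of charts. -/
lemma chartRep_eventuallyEq (α : RawForm E M k) {x₀ x₁ : M} {y : E}
    (hy : y ∈ (extChartAt 𝓘(ℝ, E) x₀).target)
    (hy' : (extChartAt 𝓘(ℝ, E) x₀).symm y ∈ (extChartAt 𝓘(ℝ, E) x₁).source) :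
    chartRep x₀ α =ᶠ[𝓝 y] fun z =>
      (chartRep x₁ α ((extChartAt 𝓘(ℝ, E) x₁ ∘ (extChartAt 𝓘(ℝ, E) x₀).symm) z)).compContinuousLinearMap
        (fderiv ℝ (extChartAt 𝓘(ℝ, E) x₁ ∘ (extChartAt 𝓘(ℝ, E) x₀).symm) z) := by
  set c₀ := extChartAt 𝓘(ℝ, E) x₀
  set c₁ := extChartAt 𝓘(ℝ, E) x₁
  have hnear : ∀ᶠ z in 𝓝 y, z ∈ c₀.target ∧ c₀.symm z ∈ c₁.source := by
    refine Filter.Eventually.and ((isOpen_extChartAt_target x₀).eventually_mem hy) ?_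
    exact (mdiff_symm hy).continuousAt.preimage_mem_nhds
      ((isOpen_extChartAt_source x₁).mem_nhds hy')
  filter_upwards [hnear.eventually_nhds] with z hz
  have hz0 := hz.self_of_nhds
  have h1 : c₁.symm (c₁ (c₀.symm z)) = c₀.symm z := c₁.left_inv hz0.2
  have h2 : mfderiv 𝓘(ℝ, E) 𝓘(ℝ, E) c₀.symm z =
      (mfderiv 𝓘(ℝ, E) 𝓘(ℝ, E) c₁.symm ((c₁ ∘ c₀.symm) z)).comp
        (mfderiv 𝓘(ℝ, E) 𝓘(ℝ, E) (c₁ ∘ c₀.symm) z) := by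
    rw [← mfderiv_comp z (mdiff_symm (c₁.map_source hz0.2))
      ((mdiff_chart hz0.2).comp z (mdiff_symm hz0.1))]
    refine Filter.EventuallyEq.mfderiv_eq ?_
    filter_upwards [hz] with w hw
    exact (c₁.left_inv hw.2).symm
  ext v
  have key : ∀ (p : M) (hp : p = c₀.symm z) (A : E →L[ℝ] E),
      (∀ j, A (v j) = (mfderiv 𝓘(ℝ, E) 𝓘(ℝ, E) c₀.symm z : E →L[ℝ] E) (v j)) →
      α (c₀.symm z) (fun j => (mfderiv 𝓘(ℝ, E) 𝓘(ℝ, E) c₀.symm z : E →L[ℝ] E) (v j)) =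
        α p (fun j => A (v j)) := by
    rintro p rfl A hA
    simp only [hA]
  refine key _ h1 ((mfderiv 𝓘(ℝ, E) 𝓘(ℝ, E) c₁.symm ((c₁ ∘ c₀.symm) z)).comp
        (fderiv ℝ (c₁ ∘ c₀.symm) z)) fun j => ?_
  rw [h2, mfderiv_eq_fderiv]
  rfl

lemma chartRep_extDerivForm {α : RawForm E M k} (hα : IsSmooth α) {x₀ : M} {y : E}
    (hy : y ∈ (extChartAt 𝓘(ℝ, E) x₀).target) :
    chartRep x₀ (extDerivForm α) y = extDeriv (chartRep x₀ α) y := by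
  set x := (extChartAt 𝓘(ℝ, E) x₀).symm y with hx
  have hxs : x ∈ (extChartAt 𝓘(ℝ, E) x).source := mem_extChartAt_source x
  rw [(chartRep_eventuallyEq α hy hxs).extDeriv_eq,
    extDeriv_pullback (r := ∞) _ (contDiffAt_transition hy hxs) minSmoothness_two_le]
  · have h := mfderiv_comp y (mdiff_chart hxs) (mdiff_symm hy)
    rw [mfderiv_eq_fderiv] at h
    refine Eq.trans ?_ (congrArg (ContinuousAlternatingMap.compContinuousLinearMap
      (extDeriv (chartRep x α) (extChartAt 𝓘(ℝ, E) x x))) h.symm)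
    rfl
  · exact ((hα x).contDiffAt ((isOpen_extChartAt_target x).mem_nhds
      (mem_extChartAt_target x))).differentiableAt (by simp)

end

lemma chartRep_add (x₀ : M) (α β : RawForm E M k) :
    chartRep x₀ (α + β) = fun y => chartRep x₀ α y + chartRep x₀ β y := rfl

lemma chartRep_smul (x₀ : M) (c : ℂ) (α : RawForm E M k) :
    chartRep x₀ (c • α) = fun y => c • chartRep x₀ α y := rfl

lemma chartRep_zero (x₀ : M) : chartRep x₀ (0 : RawForm E M k) = fun _ => 0 := rfl

lemma IsSmooth.differentiableAt {α : RawForm E M k} (hα : IsSmooth α) (x : M) :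
    DifferentiableAt ℝ (chartRep x α) (extChartAt 𝓘(ℝ, E) x x) :=
  ((hα x).contDiffAt ((isOpen_extChartAt_target x).mem_nhds
    (mem_extChartAt_target x))).differentiableAt (by simp)

lemma extDerivForm_add {α β : RawForm E M k} (hα : IsSmooth α) (hβ : IsSmooth β) :
    extDerivForm (α + β) = extDerivForm α + extDerivForm β := by
  funext x
  unfold extDerivForm
  rw [chartRep_add, extDeriv_fun_add (hα.differentiableAt x) (hβ.differentiableAt x)]
  rfl

lemma extDerivForm_smul (c : ℂ) {α : RawForm E M k} (hα : IsSmooth α) :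
    extDerivForm (c • α) = c • extDerivForm α := by
  funext x
  have h : extDeriv (fun y => c • chartRep x α y) (extChartAt 𝓘(ℝ, E) x x) =
      c • extDeriv (chartRep x α) (extChartAt 𝓘(ℝ, E) x x) := by
    ext v
    have hd : ∀ w : Fin k → E, DifferentiableAt ℝ (fun y => chartRep x α y w)
        (extChartAt 𝓘(ℝ, E) x x) :=
      fun w => (hα.differentiableAt x).continuousAlternatingMap_apply_const w
    have h1 : DifferentiableAt ℝ (fun y => c • chartRep x α y) (extChartAt 𝓘(ℝ, E) x x) :=
      (hα.differentiableAt x).const_smul c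
    rw [extDeriv_apply h1,
      ContinuousAlternatingMap.smul_apply, extDeriv_apply (hα.differentiableAt x),
      Finset.smul_sum]
    refine Finset.sum_congr rfl fun i _ => ?_
    have h2 := fderiv_const_smul (hd (i.removeNth v)) c
    have h3 : (fun y => (c • chartRep x α y) (i.removeNth v)) =
      c • fun y => chartRep x α y (i.removeNth v) := rfl
    rw [h3, h2, smul_apply, smul_comm]
  unfold extDerivForm
  rw [chartRep_smul, h]
  rfl

lemma isSmooth_zero : IsSmooth (0 : RawForm E M k) := fun x₀ => by
  rw [chartRep_zero]
  exact contDiffOn_const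

lemma extDerivForm_zero : extDerivForm (0 : RawForm E M k) = 0 := by
  have h := extDerivForm_smul (0 : ℂ) (isSmooth_zero (E := E) (M := M) (k := k))
  rwa [zero_smul, zero_smul] at h

lemma IsSmooth.add {α β : RawForm E M k} (hα : IsSmooth α) (hβ : IsSmooth β) :
    IsSmooth (α + β) := fun x₀ => (hα x₀).add (hβ x₀)

lemma IsSmooth.smul (c : ℂ) {α : RawForm E M k} (hα : IsSmooth α) :
    IsSmooth (c • α) := fun x₀ => (hα x₀).const_smul c

section
variable [IsManifold 𝓘(ℝ, E) ∞ M]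

lemma IsSmooth.extDerivForm {α : RawForm E M k} (hα : IsSmooth α) :
    IsSmooth (extDerivForm α) := by
  intro x₀
  have h : ContDiffOn ℝ ∞ (extDeriv (chartRep x₀ α)) (extChartAt 𝓘(ℝ, E) x₀).target :=
    (ContinuousAlternatingMap.alternatizeUncurryFinCLM ℝ E ℂ).contDiff.comp_contDiffOn
      ((hα x₀).fderiv_of_isOpen (isOpen_extChartAt_target x₀) (by simp))
  exact h.congr fun y hy => chartRep_extDerivForm hα hy

lemma extDerivForm_extDerivForm {α : RawForm E M k} (hα : IsSmooth α) :
    BasicForms.extDerivForm (BasicForms.extDerivForm α) = 0 := by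
  funext x
  have h : extDeriv (chartRep x (BasicForms.extDerivForm α)) (extChartAt 𝓘(ℝ, E) x x) = 0 := by
    have h1 : chartRep x (BasicForms.extDerivForm α) =ᶠ[𝓝 (extChartAt 𝓘(ℝ, E) x x)]
        extDeriv (chartRep x α) :=
      Filter.eventuallyEq_of_mem ((isOpen_extChartAt_target x).mem_nhds
        (mem_extChartAt_target x)) fun y hy => chartRep_extDerivForm hα hy
    rw [h1.extDeriv_eq]
    exact extDeriv_extDeriv_apply ((hα x).contDiffAt ((isOpen_extChartAt_target x).mem_nhds
      (mem_extChartAt_target x))) minSmoothness_two_le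
  rw [BasicForms.extDerivForm, h]
  rfl
end
end Manifolds

section Foliations

/-- A transversely holomorphic foliation of the real manifold `M`, given by a cocycle of
submersions `f i : U i → T` with connected fibres into a complex manifold `T`,
any two of which differ by a biholomorphism `γ i j` between open subsets of `T`. (`T` plays the
role of the transverse manifold; it may be the disjoint union of the images `f i (U i)`.) The leaves are
the manifolds glued from the fibres of the `f i`. -/
structure TransverselyHolomorphicFoliation
    (E : Type*) [NormedAddCommGroup E] [NormedSpace ℝ E]
    (M : Type*) [TopologicalSpace M] [ChartedSpace E M]
    (F : Type*) [NormedAddCommGroup F] [NormedSpace ℂ F]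
    (T : Type*) [TopologicalSpace T] [ChartedSpace F T] (ι : Type*) where
  /-- The open cover. -/
  U : ι → Set M
  isOpen_U : ∀ i, IsOpen (U i)
  cover : ∀ x, ∃ i, x ∈ U i
  /-- The local submersions (only their values on `U i` matter). -/
  f : ι → M → T
  smooth_f : ∀ i, ContMDiffOn 𝓘(ℝ, E) 𝓘(ℝ, F) ∞ (f i) (U i)
  submersion_f : ∀ i, ∀ x ∈ U i, Function.Surjective (mfderiv 𝓘(ℝ, E) 𝓘(ℝ, F) (f i) x)
  connected_fibres : ∀ i t, IsPreconnected (U i ∩ f i ⁻¹' {t})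
  /-- The transition maps. -/
  γ : ι → ι → OpenPartialHomeomorph T T
  holomorphic_γ : ∀ i j, (γ i j).MDifferentiable 𝓘(ℂ, F) 𝓘(ℂ, F)
  mem_source_γ : ∀ i j, ∀ x ∈ U i ∩ U j, f i x ∈ (γ i j).source
  cocycle : ∀ i j, ∀ x ∈ U i ∩ U j, f j x = γ i j (f i x)

variable {E : Type*} [NormedAddCommGroup E] [NormedSpace ℝ E]
  {M : Type*} [TopologicalSpace M] [ChartedSpace E M]
  {F : Type*} [NormedAddCommGroup F] [NormedSpace ℂ F]
  {T : Type*} [TopologicalSpace T] [ChartedSpace F T] {ι : Type*} {k : ℕ}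

lemma isManifold_real [IsManifold 𝓘(ℂ, F) ω T] : IsManifold 𝓘(ℝ, F) ∞ T := by
  refine isManifold_of_contDiffOn _ _ _ fun e e' he he' => ?_
  have h := contDiffGroupoid ω 𝓘(ℂ, F) |>.compatible he he'
  have h1 : ContDiffOn ℂ ω (e.symm ≫ₕ e') ((e.symm ≫ₕ e').source ∩ Set.range id) := h.1
  exact (h1.restrict_scalars ℝ).of_le le_top

lemma HasMFDerivAt.real {T' : Type*} [TopologicalSpace T'] [ChartedSpace F T'] {φ : T → T'} {t : T} {L : F →L[ℂ] F}
    (h : HasMFDerivAt 𝓘(ℂ, F) 𝓘(ℂ, F) φ t L) :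
    HasMFDerivAt 𝓘(ℝ, F) 𝓘(ℝ, F) φ t (L.restrictScalars ℝ) :=
  ⟨h.1, HasFDerivWithinAt.restrictScalars ℝ h.2⟩

namespace TransverselyHolomorphicFoliation
variable (𝓕 : TransverselyHolomorphicFoliation E M F T ι)

/-- The differential of `f i` at `x`. For `x ∈ U i` its kernel is the tangent space of the leaf
through `x`, and it identifies the normal space of the leaf with the tangent space of the complex
manifold `T` at `f i x`, that is, with the complex vector space `F`. -/
def transDeriv (i : ι) (x : M) : TangentSpace 𝓘(ℝ, E) x →L[ℝ] F :=
  mfderiv 𝓘(ℝ, E) 𝓘(ℝ, F) (𝓕.f i) x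

/-- `α x` vanishes as soon as one of its arguments is tangent to the leaf through `x`. -/
def IsHorizontal (α : RawForm E M k) : Prop :=
  ∀ i, ∀ x ∈ 𝓕.U i, ∀ v : Fin k → TangentSpace 𝓘(ℝ, E) x,
    (∃ j, 𝓕.transDeriv i x (v j) = 0) → α x v = 0

/-- The complex vector space `Ω^k(M/𝓕, ℂ)` of complex valued basic `k`-forms: the smooth forms
`α` such that `i_X α = i_X dα = 0` for all vectors `X` tangent to the leaves. -/
def basicForms (k : ℕ) : Submodule ℂ (RawForm E M k) where
  carrier := {α | IsSmooth α ∧ 𝓕.IsHorizontal α ∧ 𝓕.IsHorizontal (extDerivForm α)}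
  add_mem' {α β} hα hβ := by
    refine ⟨hα.1.add hβ.1, fun i x hx v hv => ?_, ?_⟩
    · exact (congrArg₂ (· + ·) (hα.2.1 i x hx v hv) (hβ.2.1 i x hx v hv)).trans (add_zero 0)
    · rw [extDerivForm_add hα.1 hβ.1]
      intro i x hx v hv
      exact (congrArg₂ (· + ·) (hα.2.2 i x hx v hv) (hβ.2.2 i x hx v hv)).trans (add_zero 0)
  zero_mem' := by
    refine ⟨isSmooth_zero, fun i x hx v hv => rfl, ?_⟩
    rw [extDerivForm_zero]
    exact fun i x hx v hv => rfl
  smul_mem' c α hα := by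
    refine ⟨hα.1.smul c, fun i x hx v hv => ?_, ?_⟩
    · exact (congrArg (c • ·) (hα.2.1 i x hx v hv)).trans (smul_zero c)
    · rw [extDerivForm_smul c hα.1]
      intro i x hx v hv
      exact (congrArg (c • ·) (hα.2.2 i x hx v hv)).trans (smul_zero c)

/-- The exterior derivative `d : Ω^k(M/𝓕, ℂ) → Ω^{k+1}(M/𝓕, ℂ)`. -/
def d [IsManifold 𝓘(ℝ, E) ∞ M] (k : ℕ) : 𝓕.basicForms k →ₗ[ℂ] 𝓕.basicForms (k + 1) where
  toFun α := ⟨extDerivForm α.1, α.2.1.extDerivForm, α.2.2.2, by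
    rw [extDerivForm_extDerivForm α.2.1]
    exact fun i x hx v hv => rfl⟩
  map_add' α β := Subtype.ext (extDerivForm_add α.2.1 β.2.1)
  map_smul' c α := Subtype.ext (extDerivForm_smul c α.2.1)

/-- The basic forms of type `(p, q)`: those which satisfy
`α (λ v₁, …, λ v_k) = λ ^ p * conj λ ^ q * α (v₁, …, v_k)` for all complex numbers `λ`, where `λ`
acts on the normal spaces by their complex structure. (For real `λ` this forces `p + q = k`
if `α ≠ 0`.) -/
def typeForms (k p q : ℕ) : Submodule ℂ (𝓕.basicForms k) where
  carrier := {α | ∀ (c : ℂ) (i : ι), ∀ x ∈ 𝓕.U i, ∀ v w : Fin k → TangentSpace 𝓘(ℝ, E) x,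
    (∀ j, 𝓕.transDeriv i x (w j) = c • 𝓕.transDeriv i x (v j)) →
      α.1 x w = c ^ p * (starRingEnd ℂ c) ^ q * α.1 x v}
  add_mem' {α β} hα hβ c i x hx v w hvw := by
    refine (congrArg₂ (· + ·) (hα c i x hx v w hvw) (hβ c i x hx v w hvw)).trans ?_
    exact (mul_add _ _ _).symm
  zero_mem' c i x hx v w hvw := (mul_zero _).symm
  smul_mem' b α hα c i x hx v w hvw := by
    refine (congrArg (b • ·) (hα c i x hx v w hvw)).trans ?_
    exact mul_left_comm _ _ _

lemma exists_transDeriv_eq (i j : ι) {x : M} (hi : x ∈ 𝓕.U i) (hj : x ∈ 𝓕.U j) :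
    ∃ A : F →L[ℂ] F, ∀ v, 𝓕.transDeriv j x v = A (𝓕.transDeriv i x v) := by
  have h1 := ((𝓕.holomorphic_γ i j).mdifferentiableAt
    (𝓕.mem_source_γ i j x ⟨hi, hj⟩)).hasMFDerivAt
  have h2 : HasMFDerivAt 𝓘(ℝ, E) 𝓘(ℝ, F) (𝓕.f i) x (𝓕.transDeriv i x) :=
    (((𝓕.smooth_f i).contMDiffAt ((𝓕.isOpen_U i).mem_nhds hi)).mdifferentiableAt
      (by simp)).hasMFDerivAt
  have h3 := (HasMFDerivAt.real h1).comp x h2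
  have h4 : 𝓕.f j =ᶠ[𝓝 x] 𝓕.γ i j ∘ 𝓕.f i :=
    Filter.eventuallyEq_of_mem (((𝓕.isOpen_U i).inter (𝓕.isOpen_U j)).mem_nhds ⟨hi, hj⟩)
      fun z hz => 𝓕.cocycle i j z hz
  exact ⟨mfderiv 𝓘(ℂ, F) 𝓘(ℂ, F) (𝓕.γ i j) (𝓕.f i x),
    fun v => DFunLike.congr_fun ((h3.congr_of_eventuallyEq h4).mfderiv) v⟩

lemma exists_lift [FiniteDimensional ℂ F] (c : ℂ) (x : M) :
    ∃ L : TangentSpace 𝓘(ℝ, E) x →L[ℝ] TangentSpace 𝓘(ℝ, E) x,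
      ∀ i, x ∈ 𝓕.U i → ∀ v, 𝓕.transDeriv i x (L v) = c • 𝓕.transDeriv i x v := by
  obtain ⟨i, hi⟩ := 𝓕.cover x
  have : FiniteDimensional ℝ F := FiniteDimensional.complexToReal F
  obtain ⟨R, hR⟩ := (𝓕.transDeriv i x).toLinearMap.exists_rightInverse_of_surjective
    (LinearMap.range_eq_top.2 (𝓕.submersion_f i x hi))
  refine ⟨(LinearMap.toContinuousLinearMap R).comp
    ((c • ContinuousLinearMap.id ℝ F).comp (𝓕.transDeriv i x)), fun j hj v => ?_⟩
  obtain ⟨A, hA⟩ := 𝓕.exists_transDeriv_eq i j hi hj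
  rw [hA, hA]
  have h : 𝓕.transDeriv i x (R (c • 𝓕.transDeriv i x v)) = c • 𝓕.transDeriv i x v :=
    LinearMap.congr_fun hR _
  refine (congrArg A h).trans ?_
  exact A.map_smul c _

/-- A linear endomorphism of `T_x M` which induces on the normal space of the leaf the
multiplication by the complex number `c`. -/
def lift [FiniteDimensional ℂ F] (c : ℂ) (x : M) :
    TangentSpace 𝓘(ℝ, E) x →L[ℝ] TangentSpace 𝓘(ℝ, E) x :=
  (𝓕.exists_lift c x).choose

end TransverselyHolomorphicFoliation

lemma exists_complex_chartDeriv [IsManifold 𝓘(ℂ, F) ω T] {t₀ t : T}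
    (ht : t ∈ (extChartAt 𝓘(ℝ, F) t₀).source) :
    ∃ A : F →L[ℂ] F, HasMFDerivAt 𝓘(ℝ, F) 𝓘(ℝ, F) (extChartAt 𝓘(ℝ, F) t₀) t
      (A.restrictScalars ℝ) ∧ Function.Bijective A := by
  have ht' : t ∈ (chartAt F t₀).source := by simpa using ht
  have : IsManifold 𝓘(ℂ, F) 1 T := IsManifold.of_le (n := ω) le_top
  have h1 : MDifferentiableAt 𝓘(ℂ, F) 𝓘(ℂ, F) (extChartAt 𝓘(ℂ, F) t₀) t :=
    mdifferentiableAt_extChartAt ht'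
  refine ⟨mfderiv 𝓘(ℂ, F) 𝓘(ℂ, F) (extChartAt 𝓘(ℂ, F) t₀) t,
    HasMFDerivAt.real (T' := F) h1.hasMFDerivAt, ?_⟩
  obtain ⟨e, he⟩ := isInvertible_mfderiv_extChartAt (I := 𝓘(ℂ, F)) (x := t₀) (y := t)
    (by simpa using ht')
  rw [← he]
  exact e.bijective

namespace TransverselyHolomorphicFoliation
variable (𝓕 : TransverselyHolomorphicFoliation E M F T ι)

lemma transDeriv_lift [FiniteDimensional ℂ F] (c : ℂ) {i : ι} {x : M} (hx : x ∈ 𝓕.U i)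
    (v : TangentSpace 𝓘(ℝ, E) x) :
    𝓕.transDeriv i x (𝓕.lift c x v) = c • 𝓕.transDeriv i x v :=
  (𝓕.exists_lift c x).choose_spec i hx v

/-- The map `f i` in the charts at `x₀` and `t₀`. -/
def localMap (i : ι) (x₀ : M) (t₀ : T) : E → F :=
  extChartAt 𝓘(ℝ, F) t₀ ∘ 𝓕.f i ∘ (extChartAt 𝓘(ℝ, E) x₀).symm

/-- The domain of `localMap`. -/
def localDomain (i : ι) (x₀ : M) (t₀ : T) : Set E :=
  (extChartAt 𝓘(ℝ, E) x₀).target ∩ (extChartAt 𝓘(ℝ, E) x₀).symm ⁻¹'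
    (𝓕.U i ∩ 𝓕.f i ⁻¹' (extChartAt 𝓘(ℝ, F) t₀).source)

lemma isOpen_localDomain (i : ι) (x₀ : M) (t₀ : T) : IsOpen (𝓕.localDomain i x₀ t₀) := by
  refine (continuousOn_extChartAt_symm x₀).isOpen_inter_preimage (isOpen_extChartAt_target x₀) ?_
  exact (𝓕.smooth_f i).continuousOn.isOpen_inter_preimage (𝓕.isOpen_U i)
    (isOpen_extChartAt_source t₀)

variable [IsManifold 𝓘(ℝ, E) ∞ M] [IsManifold 𝓘(ℂ, F) ω T]

lemma contDiffOn_localMap (i : ι) (x₀ : M) (t₀ : T) :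
    ContDiffOn ℝ ∞ (𝓕.localMap i x₀ t₀) (𝓕.localDomain i x₀ t₀) := by
  have : IsManifold 𝓘(ℝ, F) ∞ T := isManifold_real
  rw [← contMDiffOn_iff_contDiffOn]
  refine (contMDiffOn_extChartAt (n := ∞) (x := t₀)).comp (t := (chartAt F t₀).source)
    ((𝓕.smooth_f i).comp ((contMDiffOn_extChartAt_symm (n := ∞) x₀).mono fun y hy => hy.1)
      fun y hy => hy.2.1) fun y hy => ?_
  have := hy.2.2
  simpa using this

/-- The inverse chart has an invertible derivative. -/
lemma exists_lift_chart {x₀ : M} {y : E} (hy : y ∈ (extChartAt 𝓘(ℝ, E) x₀).target)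
    (w : TangentSpace 𝓘(ℝ, E) ((extChartAt 𝓘(ℝ, E) x₀).symm y)) :
    ∃ v : E, mfderiv 𝓘(ℝ, E) 𝓘(ℝ, E) (extChartAt 𝓘(ℝ, E) x₀).symm y v = w := by
  have : IsManifold 𝓘(ℝ, E) 1 M := IsManifold.of_le (n := ∞) (by simp)
  have h := mfderivWithin_extChartAt_symm_comp_mfderiv_extChartAt (I := 𝓘(ℝ, E)) hy
  simp only [modelWithCornersSelf_coe, Set.range_id, mfderivWithin_univ] at h
  exact ⟨mfderiv 𝓘(ℝ, E) 𝓘(ℝ, E) (extChartAt 𝓘(ℝ, E) x₀) ((extChartAt 𝓘(ℝ, E) x₀).symm y) w,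
    DFunLike.congr_fun h w⟩

lemma exists_fderiv_localMap {i : ι} {x₀ : M} {t₀ : T} {y : E}
    (hy : y ∈ 𝓕.localDomain i x₀ t₀) :
    ∃ A : F →L[ℂ] F, Function.Bijective A ∧ ∀ v : E, fderiv ℝ (𝓕.localMap i x₀ t₀) y v =
      A (𝓕.transDeriv i ((extChartAt 𝓘(ℝ, E) x₀).symm y)
        (mfderiv 𝓘(ℝ, E) 𝓘(ℝ, E) (extChartAt 𝓘(ℝ, E) x₀).symm y v)) := by
  obtain ⟨A, hA, hb⟩ := exists_complex_chartDeriv hy.2.2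
  refine ⟨A, hb, fun v => ?_⟩
  have h2 : HasMFDerivAt 𝓘(ℝ, E) 𝓘(ℝ, F) (𝓕.f i) ((extChartAt 𝓘(ℝ, E) x₀).symm y)
      (𝓕.transDeriv i ((extChartAt 𝓘(ℝ, E) x₀).symm y)) :=
    (((𝓕.smooth_f i).contMDiffAt ((𝓕.isOpen_U i).mem_nhds hy.2.1)).mdifferentiableAt
      (by simp)).hasMFDerivAt
  have h3 := HasMFDerivAt.comp y (f := 𝓕.f i ∘ (extChartAt 𝓘(ℝ, E) x₀).symm) hA
    (h2.comp y (mdiff_symm hy.1).hasMFDerivAt)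
  rw [← mfderiv_eq_fderiv]
  exact DFunLike.congr_fun h3.mfderiv v

variable [FiniteDimensional ℂ F]

/-- A basic form is locally the pullback of a form on the transverse manifold. -/
lemma exists_local_form [FiniteDimensional ℝ E] (α : 𝓕.basicForms k) {i : ι} {x₀ : M} {t₀ : T} {y₀ : E}
    (hy₀ : y₀ ∈ 𝓕.localDomain i x₀ t₀) :
    ∃ (b : F → F [⋀^Fin k]→L[ℝ] ℂ) (V : Set F) (W' : Set E), IsOpen V ∧ IsOpen W' ∧ y₀ ∈ W' ∧
      W' ⊆ 𝓕.localDomain i x₀ t₀ ∧ Set.MapsTo (𝓕.localMap i x₀ t₀) W' V ∧ ContDiffOn ℝ ∞ b V ∧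
      ∀ y ∈ W', chartRep x₀ α.1 y = (b (𝓕.localMap i x₀ t₀ y)).compContinuousLinearMap
        (fderiv ℝ (𝓕.localMap i x₀ t₀) y) := by
  have : FiniteDimensional ℝ F := FiniteDimensional.complexToReal F
  refine exists_local_descent (𝓕.isOpen_localDomain i x₀ t₀) hy₀ (𝓕.contDiffOn_localMap i x₀ t₀)
    ?_ ((α.2.1 x₀).mono fun y hy => hy.1) ?_ ?_
  · intro y hy u
    obtain ⟨A, hA, h⟩ := 𝓕.exists_fderiv_localMap hy
    obtain ⟨u', rfl⟩ := hA.2 u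
    obtain ⟨w, rfl⟩ := 𝓕.submersion_f i _ hy.2.1 u'
    obtain ⟨v, rfl⟩ := exists_lift_chart hy.1 w
    exact ⟨v, h v⟩
  · rintro y hy v ⟨j, hj⟩
    obtain ⟨A, hA, h⟩ := 𝓕.exists_fderiv_localMap hy
    rw [h] at hj
    exact α.2.2.1 i _ hy.2.1 _ ⟨j, (map_eq_zero_iff A hA.1).1 hj⟩
  · rintro y hy v ⟨j, hj⟩
    obtain ⟨A, hA, h⟩ := 𝓕.exists_fderiv_localMap hy
    rw [h] at hj
    rw [← chartRep_extDerivForm α.2.1 hy.1]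
    exact α.2.2.2 i _ hy.2.1 _ ⟨j, (map_eq_zero_iff A hA.1).1 hj⟩

/-- The pointwise action of a complex number on basic forms. -/
def scaleRaw (c : ℂ) (α : RawForm E M k) : RawForm E M k := fun x =>
  (α x).compContinuousLinearMap (𝓕.lift c x)

lemma scaleRaw_local_form (c : ℂ) (α : 𝓕.basicForms k) {i : ι} {x₀ : M} {t₀ : T} {y : E}
    (hy : y ∈ 𝓕.localDomain i x₀ t₀) {b : F [⋀^Fin k]→L[ℝ] ℂ}
    (hb : chartRep x₀ α.1 y = b.compContinuousLinearMap (fderiv ℝ (𝓕.localMap i x₀ t₀) y)) :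
    chartRep x₀ (𝓕.scaleRaw c α.1) y =
      (b.compContinuousLinearMap (c • ContinuousLinearMap.id ℝ F)).compContinuousLinearMap
        (fderiv ℝ (𝓕.localMap i x₀ t₀) y) := by
  ext v
  obtain ⟨A, hA, h⟩ := 𝓕.exists_fderiv_localMap hy
  choose w hw using fun j => exists_lift_chart hy.1
    (𝓕.lift c _ (mfderiv 𝓘(ℝ, E) 𝓘(ℝ, E) (extChartAt 𝓘(ℝ, E) x₀).symm y (v j)))
  have h1 : chartRep x₀ (𝓕.scaleRaw c α.1) y v = chartRep x₀ α.1 y w :=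
    (congrArg (α.1 ((extChartAt 𝓘(ℝ, E) x₀).symm y)) (funext hw)).symm
  rw [h1, hb]
  refine congrArg b (funext fun j => ?_)
  have h2 : fderiv ℝ (𝓕.localMap i x₀ t₀) y (w j) =
      c • fderiv ℝ (𝓕.localMap i x₀ t₀) y (v j) := by
    rw [h, h, hw, 𝓕.transDeriv_lift c hy.2.1, A.map_smul]
  exact h2

lemma scaleRaw_mem [FiniteDimensional ℝ E] (c : ℂ) (α : 𝓕.basicForms k) : 𝓕.scaleRaw c α.1 ∈ 𝓕.basicForms k := by
  have : FiniteDimensional ℝ F := FiniteDimensional.complexToReal F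
  -- the form `c^* b` on the transverse manifold
  have hloc : ∀ (i : ι) (x₀ : M) (y₀ : E), y₀ ∈ (extChartAt 𝓘(ℝ, E) x₀).target →
      (extChartAt 𝓘(ℝ, E) x₀).symm y₀ ∈ 𝓕.U i →
      ContDiffAt ℝ ∞ (chartRep x₀ (𝓕.scaleRaw c α.1)) y₀ ∧
      ∃ (B : F [⋀^Fin (k + 1)]→L[ℝ] ℂ) (A : F →L[ℂ] F), ∀ v : Fin (k + 1) → E,
        extDeriv (chartRep x₀ (𝓕.scaleRaw c α.1)) y₀ v = B fun j =>
          A (𝓕.transDeriv i ((extChartAt 𝓘(ℝ, E) x₀).symm y₀)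
            (mfderiv 𝓘(ℝ, E) 𝓘(ℝ, E) (extChartAt 𝓘(ℝ, E) x₀).symm y₀ (v j))) := by
    intro i x₀ y₀ hy₀ hi
    set t₀ := 𝓕.f i ((extChartAt 𝓘(ℝ, E) x₀).symm y₀) with ht₀
    have hdom : y₀ ∈ 𝓕.localDomain i x₀ t₀ := ⟨hy₀, hi, mem_extChartAt_source t₀⟩
    obtain ⟨b, V, W', hV, hW', hyW', hsub, hmaps, hb, hrep⟩ := 𝓕.exists_local_form α hdom
    let b' : F → F [⋀^Fin k]→L[ℝ] ℂ := fun t =>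
      (b t).compContinuousLinearMap (c • ContinuousLinearMap.id ℝ F)
    have hb' : ContDiffOn ℝ ∞ b' V := contDiffOn_pullback hb contDiffOn_const
    have hg : ContDiffOn ℝ ∞ (𝓕.localMap i x₀ t₀) W' :=
      (𝓕.contDiffOn_localMap i x₀ t₀).mono hsub
    have heq : Set.EqOn (chartRep x₀ (𝓕.scaleRaw c α.1)) (fun y =>
        (b' (𝓕.localMap i x₀ t₀ y)).compContinuousLinearMap
          (fderiv ℝ (𝓕.localMap i x₀ t₀) y)) W' := fun y hy =>
      𝓕.scaleRaw_local_form c α (hsub hy) (hrep y hy)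
    refine ⟨?_, extDeriv b' (𝓕.localMap i x₀ t₀ y₀), ?_⟩
    · refine ContDiffOn.contDiffAt (s := W') ?_ (hW'.mem_nhds hyW')
      exact (contDiffOn_pullback (hb'.comp hg hmaps)
        (hg.fderiv_of_isOpen hW' (by simp))).congr heq
    · obtain ⟨A, -, hA⟩ := 𝓕.exists_fderiv_localMap hdom
      refine ⟨A, fun v => ?_⟩
      rw [(Filter.eventuallyEq_of_mem (hW'.mem_nhds hyW') heq).extDeriv_eq,
        extDeriv_pullback (r := ∞)
          ((hb'.contDiffAt (hV.mem_nhds (hmaps hyW'))).differentiableAt (by simp))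
          (hg.contDiffAt (hW'.mem_nhds hyW')) minSmoothness_two_le]
      exact congrArg (extDeriv b' (𝓕.localMap i x₀ t₀ y₀)) (funext fun j => hA (v j))
  have hsm : IsSmooth (𝓕.scaleRaw c α.1) := by
    intro x₀ y hy
    obtain ⟨i, hi⟩ := 𝓕.cover ((extChartAt 𝓘(ℝ, E) x₀).symm y)
    exact (hloc i x₀ y hy hi).1.contDiffWithinAt
  refine ⟨hsm, ?_, ?_⟩
  · rintro i x hx v ⟨j, hj⟩
    refine α.2.2.1 i x hx _ ⟨j, ?_⟩
    refine (𝓕.transDeriv_lift c hx (v j)).trans ?_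
    rw [hj, smul_zero]
  · rintro i x hx v ⟨j, hj⟩
    have hxs : (extChartAt 𝓘(ℝ, E) x).symm (extChartAt 𝓘(ℝ, E) x x) = x :=
      extChartAt_to_inv x
    obtain ⟨-, B, A, h⟩ := hloc i x _ (mem_extChartAt_target x) (by rwa [hxs])
    refine (h _).trans (B.map_coord_zero j ?_)
    refine (congrArg A ?_).trans A.map_zero
    rw [← hj]
    have hf : HasMFDerivAt 𝓘(ℝ, E) 𝓘(ℝ, F) (𝓕.f i)
        ((extChartAt 𝓘(ℝ, E) x).symm (extChartAt 𝓘(ℝ, E) x x)) (𝓕.transDeriv i _) :=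
      (((𝓕.smooth_f i).contMDiffAt ((𝓕.isOpen_U i).mem_nhds (by rwa [hxs]))).mdifferentiableAt
        (by simp)).hasMFDerivAt
    have h2 := HasMFDerivAt.comp x (hf.comp _ (mdiff_symm (mem_extChartAt_target x)).hasMFDerivAt)
      (mdiff_chart (mem_extChartAt_source x)).hasMFDerivAt
    have h3 : 𝓕.f i =ᶠ[𝓝 x]
        (𝓕.f i ∘ (extChartAt 𝓘(ℝ, E) x).symm) ∘ extChartAt 𝓘(ℝ, E) x :=
      Filter.eventuallyEq_of_mem (extChartAt_source_mem_nhds x) fun z hz =>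
        congrArg (𝓕.f i) ((extChartAt 𝓘(ℝ, E) x).left_inv hz).symm
    exact (DFunLike.congr_fun (h2.congr_of_eventuallyEq h3).mfderiv (v j)).symm

/-- The action `α ↦ c^* α` of a complex number `c` on basic forms, where
`(c^* α) (v₁, …, v_k) = α (c v₁, …, c v_k)`. -/
def scale [FiniteDimensional ℝ E] (k : ℕ) (c : ℂ) : 𝓕.basicForms k →ₗ[ℂ] 𝓕.basicForms k where
  toFun α := ⟨𝓕.scaleRaw c α.1, 𝓕.scaleRaw_mem c α⟩
  map_add' _ _ := rfl
  map_smul' _ _ := rfl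

end TransverselyHolomorphicFoliation

namespace TransverselyHolomorphicFoliation
variable (𝓕 : TransverselyHolomorphicFoliation E M F T ι)
  [IsManifold 𝓘(ℝ, E) ∞ M] [IsManifold 𝓘(ℂ, F) ω T] [FiniteDimensional ℝ E]
  [FiniteDimensional ℂ F]

lemma scale_apply (c : ℂ) (α : 𝓕.basicForms k) {i : ι} {x : M} (hx : x ∈ 𝓕.U i)
    {v w : Fin k → TangentSpace 𝓘(ℝ, E) x}
    (h : ∀ j, 𝓕.transDeriv i x (w j) = c • 𝓕.transDeriv i x (v j)) :
    (𝓕.scale k c α).1 x v = α.1 x w := by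
  refine alternating_congr (α.1 x) (𝓕.transDeriv i x).toLinearMap (α.2.2.1 i x hx) _ _ fun j => ?_
  exact (𝓕.transDeriv_lift c hx (v j)).trans (h j).symm

lemma scale_of_mem_typeForms {p q : ℕ} {α : 𝓕.basicForms k} (hα : α ∈ 𝓕.typeForms k p q) (c : ℂ) :
    𝓕.scale k c α = (c ^ p * (starRingEnd ℂ c) ^ q) • α := by
  refine Subtype.ext (funext fun x => ?_)
  obtain ⟨i, hi⟩ := 𝓕.cover x
  ext v
  exact hα c i x hi v _ fun j => 𝓕.transDeriv_lift c hi (v j)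

/-- The projection of the basic `k`-forms onto the forms of type `(p, q)`, for `p + q = k`,
along the forms of the other types. Since `c^* α = c ^ p * conj c ^ q * α` on forms of type
`(p, q)`, it is the average of `conj (c ^ p * conj c ^ q) * c^* α` over the roots of unity `c` of
order `2 * k + 1`. -/
def typeProj (k p q : ℕ) : 𝓕.basicForms k →ₗ[ℂ] 𝓕.basicForms k :=
  if p + q = k then
    ((2 * k + 1 : ℕ) : ℂ)⁻¹ • ∑ m ∈ Finset.range (2 * k + 1),
      let c : ℂ := Complex.exp (2 * Real.pi * Complex.I / (2 * k + 1 : ℕ)) ^ m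
      (starRingEnd ℂ (c ^ p * (starRingEnd ℂ c) ^ q)) • 𝓕.scale k c
  else 0

lemma typeProj_of_mem {p q p' q' : ℕ} (h : p + q = k) (h' : p' + q' = k) {α : 𝓕.basicForms k}
    (hα : α ∈ 𝓕.typeForms k p' q') :
    𝓕.typeProj k p q α = if p = p' then α else 0 := by
  set N := 2 * k + 1 with hN
  set ζ : ℂ := Complex.exp (2 * Real.pi * Complex.I / (N : ℕ)) with hζ
  have hprim : IsPrimitiveRoot ζ N := Complex.isPrimitiveRoot_exp N (by omega)
  have hnorm : ‖ζ‖ = 1 := hprim.norm'_eq_one (by omega)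
  have hconj : ζ * starRingEnd ℂ ζ = 1 := by
    rw [Complex.mul_conj, Complex.normSq_eq_norm_sq, hnorm]; simp
  have hz0 : ζ ≠ 0 := hprim.ne_zero (by omega)
  have hc : starRingEnd ℂ ζ = ζ⁻¹ := eq_inv_of_mul_eq_one_right hconj
  have hval : 𝓕.typeProj k p q α =
      ((N : ℂ)⁻¹ * ∑ m ∈ Finset.range N, (ζ ^ (2 * (p' : ℤ) - 2 * p)) ^ m) • α := by
    rw [typeProj, if_pos h]
    simp only [LinearMap.smul_apply, LinearMap.sum_apply, 𝓕.scale_of_mem_typeForms hα,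
      smul_smul, ← Finset.sum_smul]
    congr 2
    refine Finset.sum_congr rfl fun m _ => ?_
    rw [← hN, ← hζ]
    simp only [map_mul, map_pow, hc, map_inv₀, inv_inv]
    simp only [← zpow_natCast, inv_zpow', ← zpow_mul, ← zpow_add₀ hz0]
    congr 1
    subst h
    have : (q' : ℤ) = p + q - p' := by omega
    rw [this]; ring
  rw [hval]
  split_ifs with hp
  · subst hp
    have : (N : ℂ) ≠ 0 := Nat.cast_ne_zero.2 (by omega)
    simp [this]
  · have hne : ζ ^ (2 * (p' : ℤ) - 2 * p) ≠ 1 := by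
      intro h1
      have h2 := (hprim.zpow_eq_one_iff_dvd _).1 h1
      have h3 := Int.eq_zero_of_abs_lt_dvd h2 (by rw [abs_lt]; constructor <;> push_cast [hN] <;> omega)
      omega
    have hpow : (ζ ^ (2 * (p' : ℤ) - 2 * p)) ^ N = 1 := by
      rw [← zpow_natCast, ← zpow_mul, mul_comm, zpow_mul, zpow_natCast, hprim.pow_eq_one,
        one_zpow]
    rw [geom_sum_eq hne, hpow]
    simp

/-- The operator `∂ = ∑ π^{p+1,q} d π^{p,q}` on basic `k`-forms. -/
def del (k : ℕ) : 𝓕.basicForms k →ₗ[ℂ] 𝓕.basicForms (k + 1) :=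
  ∑ pq ∈ Finset.HasAntidiagonal.antidiagonal k,
    𝓕.typeProj (k + 1) (pq.1 + 1) pq.2 ∘ₗ 𝓕.d k ∘ₗ 𝓕.typeProj k pq.1 pq.2

/-- The operator `∂̄ = ∑ π^{p,q+1} d π^{p,q}` on basic `k`-forms. -/
def delbar (k : ℕ) : 𝓕.basicForms k →ₗ[ℂ] 𝓕.basicForms (k + 1) :=
  ∑ pq ∈ Finset.HasAntidiagonal.antidiagonal k,
    𝓕.typeProj (k + 1) pq.1 (pq.2 + 1) ∘ₗ 𝓕.d k ∘ₗ 𝓕.typeProj k pq.1 pq.2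

/-- `Im d` in degree `k`. -/
def imD : (k : ℕ) → Submodule ℂ (𝓕.basicForms k)
  | 0 => ⊥
  | k + 1 => LinearMap.range (𝓕.d k)

/-- `Im ∂` in degree `k`. -/
def imDel : (k : ℕ) → Submodule ℂ (𝓕.basicForms k)
  | 0 => ⊥
  | k + 1 => LinearMap.range (𝓕.del k)

/-- `Im ∂̄` in degree `k`. -/
def imDelbar : (k : ℕ) → Submodule ℂ (𝓕.basicForms k)
  | 0 => ⊥
  | k + 1 => LinearMap.range (𝓕.delbar k)

/-- `Im ∂∂̄` in degree `k`. -/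
def imDelDelbar : (k : ℕ) → Submodule ℂ (𝓕.basicForms k)
  | 0 => ⊥
  | 1 => ⊥
  | k + 2 => LinearMap.range (𝓕.del (k + 1) ∘ₗ 𝓕.delbar k)

/-- The basic cohomology `H^k(M/𝓕, ℂ) = Ker d / Im d`. -/
abbrev BasicCohomology (k : ℕ) : Type _ :=
  ↥(LinearMap.ker (𝓕.d k)) ⧸ (𝓕.imD k).submoduleOf (LinearMap.ker (𝓕.d k))

/-- The closed forms of type `(p, q)` for `∂̄`. -/
def kerDelbar (p q : ℕ) : Submodule ℂ (𝓕.basicForms (p + q)) :=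
  𝓕.typeForms (p + q) p q ⊓ LinearMap.ker (𝓕.delbar (p + q))

/-- The basic Dolbeault cohomology: the part of type `(p, q)` of `Ker ∂̄ / Im ∂̄`. -/
abbrev DolbeaultCohomology (p q : ℕ) : Type _ :=
  ↥(𝓕.kerDelbar p q) ⧸ (𝓕.imDelbar (p + q)).submoduleOf (𝓕.kerDelbar p q)

/-- The forms of type `(p, q)` in `Ker ∂ ∩ Ker ∂̄`. -/
def kerBottChern (p q : ℕ) : Submodule ℂ (𝓕.basicForms (p + q)) :=
  𝓕.typeForms (p + q) p q ⊓
    (LinearMap.ker (𝓕.del (p + q)) ⊓ LinearMap.ker (𝓕.delbar (p + q)))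

/-- The basic Bott-Chern cohomology: the part of type `(p, q)` of
`(Ker ∂ ∩ Ker ∂̄) / Im ∂∂̄`. -/
abbrev BottChernCohomology (p q : ℕ) : Type _ :=
  ↥(𝓕.kerBottChern p q) ⧸ (𝓕.imDelDelbar (p + q)).submoduleOf (𝓕.kerBottChern p q)

/-- The forms of type `(p, q)` in `Ker ∂∂̄`. -/
def kerAeppli (p q : ℕ) : Submodule ℂ (𝓕.basicForms (p + q)) :=
  𝓕.typeForms (p + q) p q ⊓ LinearMap.ker (𝓕.del (p + q + 1) ∘ₗ 𝓕.delbar (p + q))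

/-- The basic Aeppli cohomology: the part of type `(p, q)` of `Ker ∂∂̄ / (Im ∂ + Im ∂̄)`. -/
abbrev AeppliCohomology (p q : ℕ) : Type _ :=
  ↥(𝓕.kerAeppli p q) ⧸
    (𝓕.imDel (p + q) ⊔ 𝓕.imDelbar (p + q)).submoduleOf (𝓕.kerAeppli p q)

/-- The `∂∂̄`-lemma for the basic Dolbeault double complex:
`Ker ∂ ∩ Ker ∂̄ ∩ Im d = Im ∂∂̄`. -/
def SatisfiesDelDelbarLemma : Prop :=
  ∀ k, LinearMap.ker (𝓕.del k) ⊓ LinearMap.ker (𝓕.delbar k) ⊓ 𝓕.imD k = 𝓕.imDelDelbar k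

end TransverselyHolomorphicFoliation
end Foliations

end BasicForms

end

/-! The statement is linear algebra in a double complex, once the basic forms are known to be one.

Algebra. Let `T` multiply the part of type `(p, q)` by `(-1) ^ p`. It anticommutes with ∂ and
commutes with ∂̄, so for `dz = 0` the forms ∂Tz and ∂̄Tz agree, and dTz = 2∂Tz. Write Z = Ker d, I =
Im d, B = Ker ∂ ∩ Ker ∂̄, S = Im ∂ + Im ∂̄, P = Im ∂∂̄ and Q = Ker ∂∂̄. The defect of the ∂∂̄-lemma
in degree k is c_k = dim (B ∩ I)/P. The flags P ⊆ B ∩ I ⊆ B and S ⊆ Z + S ⊆ Q split the Bott–Chern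
and Aeppli dimensions; d identifies Q/(Z + S) in degree k with (B ∩ I)/P in degree k + 1
(`relRank_ker_comp`). Expanding one copy of dim Z/I through B + I and the other through Z ∩ S, and
cancelling when the dimensions are finite, the difference between the two sides of the inequality is
c_k + c_{k+1} - dim Z/(B + I) - dim (Z ∩ S)/I. The operator ∂T induces an injection of Z/(B + I)
into (B ∩ I)/P one degree higher (`relRank_ker_le`) and a surjection of Q/(Z + S) onto (Z ∩ S)/I one
degree higher (`relRank_inf_sup_le`). So each subtracted term is at most one of the defects. This
gives the inequality, and equality if all defects vanish.

Conversely, equality of finite dimensions in every degree makes both of these maps bijective. For r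
in Q, surjectivity of the first gives z in Z with dr ≡ ∂Tz = d(Tz/2) modulo P, so r - Tz/2 lies in Z
+ S and ∂T(r - Tz/2) = ∂Tr - ∂z/2 is exact. But ∂z is exact: if W multiplies the type `(p, q)` by p,
then 0 = W(dz) = d(Wz) + ∂z. So ∂Tr is exact, injectivity of the second map puts r in Z + S, and the
defect one degree higher is zero.

The total cohomology is finite-dimensional because the filtration by p reduces it to finitely many
Dolbeault spaces (`relRank_ker_lt_aleph0`).

Geometry. A real multilinear form on a complex vector space splits into parts homogeneous of weight
c^p c̄^(k-p) under v ↦ cv. Orthogonality of these characters on roots of unity shows that `typeProj`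
extracts the parts, so the types decompose the basic forms. A basic form is locally pulled back from
the transverse manifold, where the formula for `extDeriv` shows that d has only components of
bidegree `(1, 0)` and `(0, 1)`; separating bidegrees in d² = 0 gives the relations between ∂ and ∂̄.
-/

noncomputable section

namespace BasicForms

/-! ### Dimensions of subquotients, as cardinals -/

section RelativeRank
universe u
variable {𝕜 : Type*} [Field 𝕜] {V W : Type u} [AddCommGroup V] [Module 𝕜 V]
  [AddCommGroup W] [Module 𝕜 W]

/-- The dimension of the image of `K` in `V ⧸ N`. -/
def relRank (K N : Submodule 𝕜 V) : Cardinal :=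
  Module.rank 𝕜 (K ⧸ N.submoduleOf K)

/-- The map need not descend to `K ⧸ N`, since `f` is not required to send `N` into `N'`. The kernel
of `K → K' ⧸ N'` is contained in `N`, which makes `K ⧸ N` a quotient of the image of that map. -/
lemma relRank_le_of_injective {K N : Submodule 𝕜 V} {K' N' : Submodule 𝕜 W} (f : V →ₗ[𝕜] W)
    (hK : ∀ x ∈ K, f x ∈ K') (hN : ∀ x ∈ K, f x ∈ N' → x ∈ N) :
    relRank K N ≤ relRank K' N' := by
  let g : K →ₗ[𝕜] K' ⧸ N'.submoduleOf K' := (N'.submoduleOf K').mkQ ∘ₗ f.restrict hK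
  have hg : LinearMap.ker g ≤ N.submoduleOf K := fun x hx => by
    have : f.restrict hK x ∈ N'.submoduleOf K' := (Submodule.Quotient.mk_eq_zero _).1 hx
    exact hN x x.2 this
  calc relRank K N ≤ Module.rank 𝕜 (K ⧸ LinearMap.ker g) :=
        LinearMap.rank_le_of_surjective (Submodule.factor hg) (Submodule.factor_surjective hg)
    _ = Module.rank 𝕜 (LinearMap.range g) := g.quotKerEquivRange.rank_eq
    _ ≤ _ := Submodule.rank_le _

lemma relRank_le_of_surjective {K N : Submodule 𝕜 V} {K' N' : Submodule 𝕜 W} (f : V →ₗ[𝕜] W)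
    (hK : ∀ x ∈ K, f x ∈ K') (hN : ∀ x ∈ K, x ∈ N → f x ∈ N')
    (hs : ∀ y ∈ K', ∃ x ∈ K, y - f x ∈ N') :
    relRank K' N' ≤ relRank K N := by
  refine LinearMap.rank_le_of_surjective (Submodule.mapQ (N.submoduleOf K) (N'.submoduleOf K')
    (f.restrict hK) fun x hx => hN x x.2 hx) fun y => ?_
  obtain ⟨⟨y, hy⟩, rfl⟩ := Submodule.mkQ_surjective _ y
  obtain ⟨x, hx, hxy⟩ := hs y hy
  refine ⟨Submodule.Quotient.mk ⟨x, hx⟩, Eq.symm ((Submodule.Quotient.eq _).2 hxy)⟩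

lemma relRank_eq_zero_iff {K N : Submodule 𝕜 V} : relRank K N = 0 ↔ K ≤ N := by
  rw [relRank, rank_zero_iff, Submodule.Quotient.subsingleton_iff,
    Submodule.submoduleOf_eq_top]

/-- Rank–nullity for the exact sequence 0 → L/N → K/N → K/L → 0. All the dimension counts below are
applications of this to flags. -/
lemma relRank_eq_add {N L K : Submodule 𝕜 V} (hNL : N ≤ L) (hLK : L ≤ K) :
    relRank K N = relRank K L + relRank L N := by
  let g : K ⧸ N.submoduleOf K →ₗ[𝕜] K ⧸ L.submoduleOf K :=
    Submodule.factor (Submodule.comap_mono hNL)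
  have hg : Function.Surjective g := Submodule.factor_surjective _
  let i : L ⧸ N.submoduleOf L →ₗ[𝕜] K ⧸ N.submoduleOf K :=
    Submodule.mapQ _ _ (Submodule.inclusion hLK) fun x hx => hx
  have hi : Function.Injective i := by
    refine (injective_iff_map_eq_zero i).2 fun x hx => ?_
    obtain ⟨x, rfl⟩ := Submodule.mkQ_surjective _ x
    exact (Submodule.Quotient.mk_eq_zero _).2
      ((Submodule.Quotient.mk_eq_zero (N.submoduleOf K)).1 hx : Submodule.inclusion hLK x ∈ _)
  have hr : LinearMap.range i = LinearMap.ker g := by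
    ext y
    obtain ⟨⟨y, hy⟩, rfl⟩ := Submodule.mkQ_surjective _ y
    constructor
    · rintro ⟨x, hx⟩
      obtain ⟨⟨x, hxL⟩, rfl⟩ := Submodule.mkQ_surjective _ x
      have h1 : x - y ∈ N := (Submodule.Quotient.eq (N.submoduleOf K)).1 hx
      refine (Submodule.Quotient.mk_eq_zero _).2 ?_
      change y ∈ L
      simpa using L.sub_mem hxL (hNL h1)
    · intro h
      have h1 : y ∈ L := (Submodule.Quotient.mk_eq_zero (L.submoduleOf K)).1 h
      exact ⟨Submodule.Quotient.mk ⟨y, h1⟩, rfl⟩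
  have h1 := g.rank_range_add_rank_ker
  rw [← hr, rank_range_of_surjective g hg, rank_range_of_injective i hi] at h1
  exact h1.symm

lemma relRank_sup (K L : Submodule 𝕜 V) : relRank (K ⊔ L) L = relRank K (K ⊓ L) := by
  refine le_antisymm ?_ ?_
  · refine relRank_le_of_surjective LinearMap.id (fun x hx => Submodule.mem_sup_left hx)
      (fun x _ h => h.2) fun y hy => ?_
    obtain ⟨a, ha, b, hb, rfl⟩ := Submodule.mem_sup.1 hy
    exact ⟨a, ha, by simpa using hb⟩
  · exact relRank_le_of_injective LinearMap.id (fun x hx => Submodule.mem_sup_left hx)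
      (fun x hx h => ⟨hx, h⟩)

lemma relRank_mono_left {K K' : Submodule 𝕜 V} (N : Submodule 𝕜 V) (h : K ≤ K') :
    relRank K N ≤ relRank K' N :=
  relRank_le_of_injective LinearMap.id (fun _ hx => h hx) fun _ _ hx => hx

/-- An injective linear map of quotients of the same finite dimension is surjective. -/
lemma exists_sub_mem_of_relRank_le {K N : Submodule 𝕜 V} {K' N' : Submodule 𝕜 W} (f : V →ₗ[𝕜] W)
    (hK : ∀ x ∈ K, f x ∈ K') (hN : ∀ x ∈ K, f x ∈ N' → x ∈ N) (hN' : N' ≤ K')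
    (hfin : relRank K' N' < Cardinal.aleph0) (hle : relRank K' N' ≤ relRank K N) :
    ∀ y ∈ K', ∃ x ∈ K, y - f x ∈ N' := by
  have h1 : K.map f ⊔ N' ≤ K' := sup_le (Submodule.map_le_iff_le_comap.2 hK) hN'
  have h2 : relRank K N ≤ relRank (K.map f ⊔ N') N' :=
    relRank_le_of_injective f
      (fun x hx => Submodule.mem_sup_left (Submodule.mem_map_of_mem hx)) hN
  have h3 := relRank_eq_add (le_sup_right : N' ≤ K.map f ⊔ N') h1
  -- The rank of `K'` over `N'` is this rank plus one that is at least as large as the whole.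
  -- Cancellation needs finite cardinals, whence the passage to `ℕ`.
  have h4 : relRank K' (K.map f ⊔ N') = 0 := by
    have h5 : relRank (K.map f ⊔ N') N' < Cardinal.aleph0 :=
      (relRank_mono_left N' h1).trans_lt hfin
    have h6 : relRank K' (K.map f ⊔ N') < Cardinal.aleph0 :=
      (le_self_add.trans h3.ge).trans_lt hfin
    have h7 := hle.trans h2
    rw [h3] at h7
    generalize relRank K' (K.map f ⊔ N') = a at *
    generalize relRank (K.map f ⊔ N') N' = b at *
    lift a to ℕ using h6
    lift b to ℕ using h5
    norm_cast at h7 ⊢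
    omega
  intro y hy
  obtain ⟨_, ⟨x, hx, rfl⟩, b, hb, rfl⟩ := Submodule.mem_sup.1 (relRank_eq_zero_iff.1 h4 hy)
  exact ⟨x, hx, by simpa using hb⟩

/-- A surjective linear map of quotients of the same finite dimension is injective. -/
lemma mem_of_relRank_le {K N : Submodule 𝕜 V} {K' N' : Submodule 𝕜 W} (f : V →ₗ[𝕜] W)
    (hK : ∀ x ∈ K, f x ∈ K') (hN : ∀ x ∈ K, x ∈ N → f x ∈ N')
    (hs : ∀ y ∈ K', ∃ x ∈ K, y - f x ∈ N') (hNK : N ≤ K)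
    (hfin : relRank K N < Cardinal.aleph0) (hle : relRank K N ≤ relRank K' N') :
    ∀ x ∈ K, f x ∈ N' → x ∈ N := by
  have h1 : N ≤ K ⊓ N'.comap f := fun x hx => ⟨hNK hx, hN x (hNK hx) hx⟩
  have h2 : relRank K' N' ≤ relRank K (K ⊓ N'.comap f) :=
    relRank_le_of_surjective f hK (fun x _ h => h.2) hs
  have h3 := relRank_eq_add h1 inf_le_left
  have h4 : relRank (K ⊓ N'.comap f) N = 0 := by
    have h5 : relRank (K ⊓ N'.comap f) N < Cardinal.aleph0 :=
      (relRank_mono_left N inf_le_left).trans_lt hfin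
    have h6 : relRank K (K ⊓ N'.comap f) < Cardinal.aleph0 :=
      (le_self_add.trans h3.ge).trans_lt hfin
    have h7 := hle.trans h2
    rw [h3] at h7
    generalize relRank K (K ⊓ N'.comap f) = a at *
    generalize relRank (K ⊓ N'.comap f) N = b at *
    lift a to ℕ using h6
    lift b to ℕ using h5
    norm_cast at h7 ⊢
    omega
  exact fun x hx hfx => relRank_eq_zero_iff.1 h4 ⟨hx, hfx⟩

lemma rank_pi_fin {n : ℕ} (X : Fin n → Type u) [∀ i, AddCommGroup (X i)]
    [∀ i, Module 𝕜 (X i)] : Module.rank 𝕜 (∀ i, X i) = ∑ i, Module.rank 𝕜 (X i) := by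
  induction n with
  | zero => simp
  | succ n ih =>
    rw [← (Fin.consLinearEquiv 𝕜 X).rank_eq, rank_prod', ih, Fin.sum_univ_succ]

/-- The rank of a quotient of submodules compatible with a direct sum decomposition. -/
lemma relRank_eq_sum {n : ℕ} (π : Fin n → V →ₗ[𝕜] V)
    (hπ : ∀ i j x, π i (π j x) = if i = j then π i x else 0) (hsum : ∀ x, ∑ i, π i x = x)
    {K N : Submodule 𝕜 V} (hK : ∀ i, ∀ x ∈ K, π i x ∈ K) (hN : ∀ i, ∀ x ∈ N, π i x ∈ N) :
    relRank K N = ∑ i, relRank (LinearMap.range (π i) ⊓ K) N := by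
  let L : Fin n → Submodule 𝕜 V := fun i => LinearMap.range (π i) ⊓ K
  let Φ : K →ₗ[𝕜] ∀ i, L i ⧸ N.submoduleOf (L i) := LinearMap.pi fun i =>
    (N.submoduleOf (L i)).mkQ ∘ₗ
      (π i).restrict (p := K) (q := L i) fun x hx => ⟨⟨x, rfl⟩, hK i x hx⟩
  have hker : LinearMap.ker Φ = N.submoduleOf K := by
    ext x
    have h : x ∈ LinearMap.ker Φ ↔ ∀ i, π i x ∈ N := by
      rw [LinearMap.mem_ker, funext_iff]
      exact forall_congr' fun i => Submodule.Quotient.mk_eq_zero _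
    rw [h]
    refine ⟨fun h => ?_, fun h i => hN i x h⟩
    change (x : V) ∈ N
    rw [← hsum x]
    exact N.sum_mem fun i _ => h i
  have hsurj : Function.Surjective Φ := by
    intro y
    choose z hz using fun i => Submodule.mkQ_surjective _ (y i)
    refine ⟨⟨∑ i, (z i : V), K.sum_mem fun i _ => (z i).2.2⟩, funext fun i => ?_⟩
    rw [← hz i]
    refine congrArg (N.submoduleOf (L i)).mkQ (Subtype.ext ?_)
    change π i (∑ j, (z j : V)) = z i
    rw [map_sum]
    have h : ∀ j, π i (z j : V) = if i = j then (z i : V) else 0 := by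
      intro j
      obtain ⟨w, hw⟩ := (z j).2.1
      rw [← hw, hπ]
      split_ifs with hij
      · subst hij; exact hw
      · rfl
    simp [h]
  have h1 := (Φ.quotKerEquivOfSurjective hsurj).rank_eq
  rw [hker, rank_pi_fin] at h1
  exact h1

end RelativeRank

/-! ### Abstract double complexes and the sign operator -/

section DoubleComplexes
universe u
variable {𝕜 : Type*} [Field 𝕜] {A : ℕ → Type u} [∀ k, AddCommGroup (A k)] [∀ k, Module 𝕜 (A k)]

/-- The image in degree `k` of an operator of degree one. -/
def imDeg (f : ∀ k, A k →ₗ[𝕜] A (k + 1)) : (k : ℕ) → Submodule 𝕜 (A k)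
  | 0 => ⊥
  | k + 1 => LinearMap.range (f k)

/-- The image in degree `k` of the composition of two operators of degree one. -/
def imDegTwo (f g : ∀ k, A k →ₗ[𝕜] A (k + 1)) : (k : ℕ) → Submodule 𝕜 (A k)
  | 0 => ⊥
  | 1 => ⊥
  | k + 2 => LinearMap.range (f (k + 1) ∘ₗ g k)

/-- The operators `∂` and `∂̄` of bidegree `(1, 0)` and `(0, 1)` make the spaces `A k`, bigraded by
the projections `π k p` onto the parts of type `(p, k - p)`, into a double complex. -/
structure IsDoubleComplex (del delbar : ∀ k, A k →ₗ[𝕜] A (k + 1))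
    (π : ∀ k, ℕ → A k →ₗ[𝕜] A k) : Prop where
  proj_proj : ∀ k p q x, π k p (π k q x) = if p = q then π k p x else 0
  sum_proj : ∀ k x, ∑ p ∈ Finset.range (k + 1), π k p x = x
  del_proj : ∀ k p x, del k (π k p x) = π (k + 1) (p + 1) (del k x)
  delbar_proj : ∀ k p x, delbar k (π k p x) = π (k + 1) p (delbar k x)
  del_del : ∀ k x, del (k + 1) (del k x) = 0
  delbar_delbar : ∀ k x, delbar (k + 1) (delbar k x) = 0
  delbar_del : ∀ k x, delbar (k + 1) (del k x) = -del (k + 1) (delbar k x)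

/-- The operator which multiplies the part of type `(p, k - p)` by `w p`. -/
def weight (π : ∀ k, ℕ → A k →ₗ[𝕜] A k) (w : ℕ → 𝕜) (k : ℕ) : A k →ₗ[𝕜] A k :=
  ∑ p ∈ Finset.range (k + 1), w p • π k p

namespace IsDoubleComplex
variable {del delbar : ∀ k, A k →ₗ[𝕜] A (k + 1)} {π : ∀ k, ℕ → A k →ₗ[𝕜] A k}

/-- The operator which multiplies the part of type `(p, q)` by `(-1) ^ p`. -/
abbrev sgn (π : ∀ k, ℕ → A k →ₗ[𝕜] A k) (k : ℕ) : A k →ₗ[𝕜] A k :=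
  weight π (fun p => (-1) ^ p) k

lemma inf_ker_le_ker (k : ℕ) :
    LinearMap.ker (del k) ⊓ LinearMap.ker (delbar k) ≤ LinearMap.ker (del k + delbar k) := by
  rintro x ⟨h1, h2⟩
  simp [LinearMap.mem_ker.1 h1, LinearMap.mem_ker.1 h2]

lemma imDeg_le_sup (k : ℕ) :
    imDeg (fun k => del k + delbar k) k ≤ imDeg del k ⊔ imDeg delbar k := by
  match k with
  | 0 => exact bot_le
  | k + 1 =>
    rintro _ ⟨x, rfl⟩
    exact Submodule.add_mem_sup ⟨x, rfl⟩ ⟨x, rfl⟩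

variable (h : IsDoubleComplex del delbar π)
include h

/-- The projections of index at most `k` already sum to the identity, and `π k p` is orthogonal to
each of them. -/
lemma proj_of_lt {k p : ℕ} (hp : k < p) (x : A k) : π k p x = 0 := by
  conv_lhs => rw [← h.sum_proj k x, map_sum]
  refine Finset.sum_eq_zero fun q hq => ?_
  rw [h.proj_proj, if_neg]
  have := Finset.mem_range.1 hq
  omega

lemma proj_zero_del (k : ℕ) (x : A k) : π (k + 1) 0 (del k x) = 0 := by
  conv_lhs => rw [← h.sum_proj k x, map_sum, map_sum]
  refine Finset.sum_eq_zero fun q hq => ?_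
  rw [h.del_proj, h.proj_proj, if_neg (by omega)]

/-- ∂ raises `p` by one, so it intertwines `w` with its shift. For `(-1) ^ p` this is
anticommutation; for `w p = p` it says that ∂ is its own commutator with the weight operator. -/
lemma weight_del (w : ℕ → 𝕜) (k : ℕ) (x : A k) :
    weight π w (k + 1) (del k x) = del k (weight π (fun p => w (p + 1)) k x) := by
  simp only [weight, LinearMap.sum_apply, LinearMap.smul_apply, map_sum, map_smul, h.del_proj]
  rw [Finset.sum_range_succ' _ (k + 1), h.proj_zero_del, smul_zero, add_zero]

lemma weight_delbar (w : ℕ → 𝕜) (k : ℕ) (x : A k) :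
    weight π w (k + 1) (delbar k x) = delbar k (weight π w k x) := by
  simp only [weight, LinearMap.sum_apply, LinearMap.smul_apply, map_sum, map_smul]
  -- In degree `k + 1` there is one more type, `p = k + 1`; its part of ∂̄x comes from the part of
  -- `x` of index `k + 1`, which is zero.
  rw [Finset.sum_range_succ _ (k + 1), ← h.delbar_proj, h.proj_of_lt (Nat.lt_succ_self k)]
  simp [h.delbar_proj]

lemma weight_weight (w w' : ℕ → 𝕜) (k : ℕ) (x : A k) :
    weight π w k (weight π w' k x) = weight π (fun p => w p * w' p) k x := by
  simp only [weight, LinearMap.sum_apply, LinearMap.smul_apply, map_sum, map_smul, h.proj_proj]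
  refine Finset.sum_congr rfl fun p hp => ?_
  simp only [smul_ite, smul_zero]
  rw [Finset.sum_ite_eq', if_pos hp, smul_smul, mul_comm]

lemma weight_one (k : ℕ) (x : A k) : weight π (fun _ => (1 : 𝕜)) k x = x := by
  simp only [weight, LinearMap.sum_apply, one_smul, h.sum_proj]

lemma sgn_sgn (k : ℕ) (x : A k) : sgn π k (sgn π k x) = x := by
  rw [sgn, h.weight_weight]
  simp only [← mul_pow, mul_neg, mul_one, neg_neg, one_pow, h.weight_one]

lemma sgn_del (k : ℕ) (x : A k) : sgn π (k + 1) (del k x) = -del k (sgn π k x) := by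
  rw [sgn, h.weight_del, ← map_neg]
  congr 1
  simp [weight, pow_succ, LinearMap.sum_apply]

lemma sgn_delbar (k : ℕ) (x : A k) : sgn π (k + 1) (delbar k x) = delbar k (sgn π k x) :=
  h.weight_delbar _ _ _

/-- If `dz = 0` then `∂z` is the derivative of `-∑ p • z^{p,q}`. -/
lemma del_mem_of_closed {k : ℕ} {z : A k} (hz : del k z + delbar k z = 0) :
    del k z ∈ LinearMap.range (del k + delbar k) := by
  let w : ℕ → 𝕜 := fun p => p
  refine ⟨-weight π w k z, ?_⟩
  have h1 := congrArg (weight π w (k + 1)) hz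
  -- Here `w (p + 1) = w p + 1`. Hence 0 = W(dz) = ∂(Wz + z) + ∂̄(Wz) = d(Wz) + ∂z.
  have h2 : weight π (fun p => w (p + 1)) k z = weight π w k z + z := by
    conv_rhs => rw [← h.weight_one k z, h.weight_weight]
    simp [w, weight, LinearMap.sum_apply, add_smul, Finset.sum_add_distrib]
  rw [map_add, map_zero, h.weight_del, h.weight_delbar, h2, map_add] at h1
  rw [LinearMap.add_apply, map_neg, map_neg, ← sub_eq_zero, ← neg_eq_zero, ← h1]
  abel

lemma imDegTwo_le_imDeg (k : ℕ) :
    imDegTwo del delbar k ≤ imDeg (fun k => del k + delbar k) k := by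
  match k with
  | 0 => exact bot_le
  | 1 => exact bot_le
  | k + 2 =>
    rintro _ ⟨x, rfl⟩
    exact ⟨delbar k x, by simp [h.delbar_delbar]⟩

lemma imDegTwo_le_ker (k : ℕ) :
    imDegTwo del delbar k ≤ LinearMap.ker (del k) ⊓ LinearMap.ker (delbar k) := by
  match k with
  | 0 => exact bot_le
  | 1 => exact bot_le
  | k + 2 =>
    rintro _ ⟨x, rfl⟩
    exact ⟨by simp [h.del_del], by simp [h.delbar_del, h.delbar_delbar]⟩

lemma imDeg_le_ker (k : ℕ) :
    imDeg (fun k => del k + delbar k) k ≤ LinearMap.ker (del k + delbar k) := by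
  match k with
  | 0 => exact bot_le
  | k + 1 =>
    rintro _ ⟨x, rfl⟩
    simp [h.del_del, h.delbar_delbar, h.delbar_del]

lemma ker_le_ker_comp (k : ℕ) :
    LinearMap.ker (del k + delbar k) ≤ LinearMap.ker (del (k + 1) ∘ₗ delbar k) := by
  intro x hx
  have h1 := congrArg (del (k + 1)) (LinearMap.mem_ker.1 hx)
  simpa [h.del_del] using h1

lemma sup_le_ker_comp (k : ℕ) :
    imDeg del k ⊔ imDeg delbar k ≤ LinearMap.ker (del (k + 1) ∘ₗ delbar k) := by
  match k with
  | 0 => exact sup_le bot_le bot_le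
  | k + 1 =>
    refine sup_le ?_ ?_ <;> rintro _ ⟨x, rfl⟩
    · simp [h.delbar_del, h.del_del]
    · simp [h.delbar_delbar]

/-- For `dz = 0`, the form `∂Tz` with `T = (-1)^p` is half the derivative of `Tz`. -/
lemma two_smul_del_sgn {k : ℕ} {z : A k} (hz : z ∈ LinearMap.ker (del k + delbar k)) :
    (2 : 𝕜) • del k (sgn π k z) = (del k + delbar k) (sgn π k z) := by
  have h1 := congrArg (sgn π (k + 1)) (LinearMap.mem_ker.1 hz)
  rw [LinearMap.add_apply, map_add, map_zero, h.sgn_del, h.sgn_delbar] at h1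
  rw [LinearMap.add_apply, two_smul, add_right_inj]
  exact (eq_of_neg_add_eq_zero h1)

lemma del_delbar_sgn {k : ℕ} (x : A k) :
    del (k + 1) (delbar k (sgn π k x)) = -sgn π (k + 2) (del (k + 1) (delbar k x)) := by
  rw [h.sgn_del, h.sgn_delbar, neg_neg]

lemma del_sgn_mem [CharZero 𝕜] {k : ℕ} {z : A k} (hz : z ∈ LinearMap.ker (del k + delbar k)) :
    del k (sgn π k z) ∈ LinearMap.range (del k + delbar k) := by
  refine ⟨(2 : 𝕜)⁻¹ • sgn π k z, ?_⟩
  rw [map_smul, ← h.two_smul_del_sgn hz, smul_smul, inv_mul_cancel₀ two_ne_zero, one_smul]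

/-- ∂Tz is half of dTz, hence exact, and ∂̄∂Tz = -∂∂̄Tz = T∂∂̄z vanishes because closed forms lie in
Ker ∂∂̄. -/
lemma del_sgn_mem_inf [CharZero 𝕜] {k : ℕ} {z : A k} (hz : z ∈ LinearMap.ker (del k + delbar k)) :
    del k (sgn π k z) ∈ LinearMap.ker (del (k + 1)) ⊓ LinearMap.ker (delbar (k + 1)) ⊓
      imDeg (fun k => del k + delbar k) (k + 1) := by
  refine ⟨⟨by simp [h.del_del], ?_⟩, h.del_sgn_mem hz⟩
  have h1 := h.ker_le_ker_comp k hz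
  rw [LinearMap.mem_ker, LinearMap.comp_apply] at h1
  rw [SetLike.mem_coe, LinearMap.mem_ker, h.delbar_del, h.del_delbar_sgn, h1]
  simp

/-- Injectivity of the map induced by ∂T on Ker d. If ∂Tz = ∂∂̄x then ∂z = -T∂∂̄x = ∂∂̄Tx =
∂(d(Tx)), so z - d(Tx) is killed by d and by ∂, hence by ∂̄. -/
lemma mem_sup_of_del_sgn_mem {k : ℕ} {z : A k} (hz : z ∈ LinearMap.ker (del k + delbar k))
    (hq : del k (sgn π k z) ∈ imDegTwo del delbar (k + 1)) :
    z ∈ LinearMap.ker (del k) ⊓ LinearMap.ker (delbar k) ⊔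
      imDeg (fun k => del k + delbar k) k := by
  have hker : ∀ y : A k, y ∈ LinearMap.ker (del k + delbar k) → del k y = 0 →
      y ∈ LinearMap.ker (del k) ⊓ LinearMap.ker (delbar k) := by
    intro y hy hdy
    refine ⟨hdy, ?_⟩
    rw [LinearMap.mem_ker, LinearMap.add_apply, hdy, zero_add] at hy
    exact hy
  have hdz : del k z = -sgn π (k + 1) (del k (sgn π k z)) := by
    rw [h.sgn_del, h.sgn_sgn, neg_neg]
  match k with
  -- In degree 1 the image of ∂∂̄ is zero by definition, so ∂Tz = 0 and no correction is needed.
  | 0 =>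
    have h0 : del 0 (sgn π 0 z) = 0 := hq
    refine Submodule.mem_sup_left (hker z hz ?_)
    rw [hdz, h0, map_zero, neg_zero]
  | k + 1 =>
    obtain ⟨x, hx⟩ := hq
    rw [← hx, LinearMap.comp_apply, ← h.del_delbar_sgn] at hdz
    have h1 : (del k + delbar k) (sgn π k x) ∈ LinearMap.ker (del (k + 1) + delbar (k + 1)) :=
      h.imDeg_le_ker (k + 1) ⟨_, rfl⟩
    have h2 : z - (del k + delbar k) (sgn π k x) ∈
        LinearMap.ker (del (k + 1)) ⊓ LinearMap.ker (delbar (k + 1)) := by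
      refine hker _ (Submodule.sub_mem _ hz h1) ?_
      rw [map_sub, hdz, LinearMap.add_apply, map_add, h.del_del, zero_add, sub_self]
    have hd : (del k + delbar k) (sgn π k x) ∈ imDeg (fun k => del k + delbar k) (k + 1) :=
      ⟨_, rfl⟩
    have h3 := Submodule.add_mem_sup h2 hd
    rwa [sub_add_cancel] at h3

/-- `(Ker ∂ ∩ Ker ∂̄ ∩ Im d) / Im ∂∂̄` is isomorphic to `Ker ∂∂̄ / (Ker d + Im ∂ + Im ∂̄)`. -/
lemma relRank_ker_comp (k : ℕ) :
    relRank (LinearMap.ker (del (k + 1) ∘ₗ delbar k))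
      (LinearMap.ker (del k + delbar k) ⊔ (imDeg del k ⊔ imDeg delbar k)) =
    relRank (LinearMap.ker (del (k + 1)) ⊓ LinearMap.ker (delbar (k + 1)) ⊓
      imDeg (fun k => del k + delbar k) (k + 1)) (imDegTwo del delbar (k + 1)) := by
  have hmap : ∀ x ∈ LinearMap.ker (del (k + 1) ∘ₗ delbar k), (del k + delbar k) x ∈
      LinearMap.ker (del (k + 1)) ⊓ LinearMap.ker (delbar (k + 1)) ⊓
      imDeg (fun k => del k + delbar k) (k + 1) := by
    intro x hx
    rw [LinearMap.mem_ker, LinearMap.comp_apply] at hx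
    exact ⟨⟨by simp [h.del_del, hx], by simp [h.delbar_del, h.delbar_delbar, hx]⟩, x, rfl⟩
  refine le_antisymm (relRank_le_of_injective (del k + delbar k) hmap ?_)
    (relRank_le_of_surjective (del k + delbar k) hmap ?_ ?_)
  · intro x hx hdx
    match k with
    | 0 => exact Submodule.mem_sup_left hdx
    | k + 1 =>
      obtain ⟨y, hy⟩ := hdx
      -- dx = ∂∂̄y is also d(∂̄y), so x differs from an element of Im ∂̄ by a closed form.
      have h1 : x - delbar k y ∈ LinearMap.ker (del (k + 1) + delbar (k + 1)) := by
        rw [LinearMap.mem_ker, map_sub, ← hy]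
        simp [h.delbar_delbar]
      have h2 := Submodule.add_mem_sup h1 (Submodule.mem_sup_right ⟨y, rfl⟩ :
        delbar k y ∈ imDeg del (k + 1) ⊔ imDeg delbar (k + 1))
      rwa [sub_add_cancel] at h2
  · intro x _ hx
    obtain ⟨z, hz, s, hs, rfl⟩ := Submodule.mem_sup.1 hx
    rw [map_add, LinearMap.mem_ker.1 hz, zero_add]
    match k with
    | 0 =>
      have : s = 0 := by simpa [imDeg] using hs
      rw [this, map_zero]
      exact Submodule.zero_mem _
    | k + 1 =>
      obtain ⟨_, ⟨a, rfl⟩, _, ⟨b, rfl⟩, rfl⟩ := Submodule.mem_sup.1 hs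
      -- d(∂a + ∂̄b) = ∂̄∂a + ∂∂̄b = ∂∂̄(b - a).
      refine ⟨b - a, ?_⟩
      simp [h.del_del, h.delbar_delbar, h.delbar_del]
      abel
  · rintro y ⟨⟨hy1, hy2⟩, x, rfl⟩
    refine ⟨x, ?_, by simp⟩
    simpa [h.del_del] using hy1

lemma relRank_ker_le [CharZero 𝕜] (k : ℕ) :
    relRank (LinearMap.ker (del k + delbar k)) (LinearMap.ker (del k) ⊓ LinearMap.ker (delbar k) ⊔
      imDeg (fun k => del k + delbar k) k) ≤
    relRank (LinearMap.ker (del (k + 1)) ⊓ LinearMap.ker (delbar (k + 1)) ⊓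
      imDeg (fun k => del k + delbar k) (k + 1)) (imDegTwo del delbar (k + 1)) :=
  relRank_le_of_injective (del k ∘ₗ sgn π k) (fun _ hz => h.del_sgn_mem_inf hz)
    fun _ hz hq => h.mem_sup_of_del_sgn_mem hz hq

lemma del_sgn_mem_inf_sup {k : ℕ} {x : A k} (hx : x ∈ LinearMap.ker (del (k + 1) ∘ₗ delbar k)) :
    del k (sgn π k x) ∈ LinearMap.ker (del (k + 1) + delbar (k + 1)) ⊓
      (imDeg del (k + 1) ⊔ imDeg delbar (k + 1)) := by
  rw [LinearMap.mem_ker, LinearMap.comp_apply] at hx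
  refine ⟨?_, Submodule.mem_sup_left ⟨_, rfl⟩⟩
  rw [SetLike.mem_coe, LinearMap.mem_ker, LinearMap.add_apply, h.del_del, h.delbar_del,
    h.del_delbar_sgn, hx]
  simp

/-- What makes ∂T well defined from Ker ∂∂̄ / (Ker d + Im ∂ + Im ∂̄) to forms modulo Im d. The
closed part gives half of an exact form dTz, and ∂T(∂a + ∂̄b) = ∂∂̄Tb = d(∂̄Tb). -/
lemma del_sgn_mem_imDeg [CharZero 𝕜] {k : ℕ} {x : A k} (hx : x ∈ LinearMap.ker (del k + delbar k) ⊔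
      (imDeg del k ⊔ imDeg delbar k)) :
    del k (sgn π k x) ∈ imDeg (fun k => del k + delbar k) (k + 1) := by
  obtain ⟨z, hz, s, hs, rfl⟩ := Submodule.mem_sup.1 hx
  rw [map_add, map_add]
  refine Submodule.add_mem _ (h.del_sgn_mem hz) ?_
  match k with
  | 0 =>
    have : s = 0 := by simpa [imDeg] using hs
    rw [this, map_zero, map_zero]
    exact Submodule.zero_mem _
  | k + 1 =>
    obtain ⟨_, ⟨a, rfl⟩, _, ⟨b, rfl⟩, rfl⟩ := Submodule.mem_sup.1 hs
    refine ⟨delbar k (sgn π k b), ?_⟩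
    rw [map_add, map_add, h.sgn_del, h.sgn_delbar, map_neg, h.del_del, LinearMap.add_apply,
      h.delbar_delbar]
    simp

/-- Surjectivity of the same map: y = ∂a + ∂̄b equals ∂(a - b) + db, and ∂(a - b) = ∂T(T(a - b)).
Closedness of y says ∂∂̄(a - b) = 0. -/
lemma exists_sub_del_sgn_mem {k : ℕ} {y : A (k + 1)}
    (hy : y ∈ LinearMap.ker (del (k + 1) + delbar (k + 1)) ⊓
      (imDeg del (k + 1) ⊔ imDeg delbar (k + 1))) :
    ∃ x ∈ LinearMap.ker (del (k + 1) ∘ₗ delbar k),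
      y - del k (sgn π k x) ∈ imDeg (fun k => del k + delbar k) (k + 1) := by
  obtain ⟨hz, hs⟩ := hy
  obtain ⟨_, ⟨a, rfl⟩, _, ⟨b, rfl⟩, rfl⟩ := Submodule.mem_sup.1 hs
  refine ⟨sgn π k (a - b), ?_, b, ?_⟩
  · rw [SetLike.mem_coe, LinearMap.mem_ker, LinearMap.add_apply, map_add, map_add, h.del_del,
      h.delbar_delbar, h.delbar_del] at hz
    rw [LinearMap.mem_ker, LinearMap.comp_apply, h.del_delbar_sgn, map_sub, map_sub]
    have : del (k + 1) (delbar k a) = del (k + 1) (delbar k b) := by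
      rw [zero_add, add_zero] at hz
      exact (add_neg_eq_zero.1 hz).symm
    rw [this, sub_self, map_zero, neg_zero]
  · rw [h.sgn_sgn, map_sub, LinearMap.add_apply]
    abel

/-- In positive degree the right-hand side is the rank of Ker ∂∂̄ / (Ker d + Im ∂ + Im ∂̄) one
degree lower, and ∂T maps that quotient onto the left-hand one. -/
lemma relRank_inf_sup_le [CharZero 𝕜] (k : ℕ) :
    relRank (LinearMap.ker (del k + delbar k) ⊓ (imDeg del k ⊔ imDeg delbar k))
      (imDeg (fun k => del k + delbar k) k) ≤
    relRank (LinearMap.ker (del k) ⊓ LinearMap.ker (delbar k) ⊓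
      imDeg (fun k => del k + delbar k) k) (imDegTwo del delbar k) := by
  match k with
  | 0 =>
    refine (relRank_eq_zero_iff.2 ?_).trans_le zero_le
    exact inf_le_right.trans (sup_le bot_le bot_le)
  | k + 1 =>
    rw [← h.relRank_ker_comp k]
    exact relRank_le_of_surjective (del k ∘ₗ sgn π k) (fun _ hx => h.del_sgn_mem_inf_sup hx)
      (fun _ _ hx => h.del_sgn_mem_imDeg hx) fun _ hy => h.exists_sub_del_sgn_mem hy

/-! ### Dimension counts along flags, the inequality and its equality case -/

lemma relRank_bottChern (k : ℕ) :
    relRank (LinearMap.ker (del k) ⊓ LinearMap.ker (delbar k)) (imDegTwo del delbar k) =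
      relRank (LinearMap.ker (del k) ⊓ LinearMap.ker (delbar k))
        (LinearMap.ker (del k) ⊓ LinearMap.ker (delbar k) ⊓
          imDeg (fun k => del k + delbar k) k) +
      relRank (LinearMap.ker (del k) ⊓ LinearMap.ker (delbar k) ⊓
        imDeg (fun k => del k + delbar k) k) (imDegTwo del delbar k) :=
  relRank_eq_add (le_inf (h.imDegTwo_le_ker k) (h.imDegTwo_le_imDeg k)) inf_le_left

/-- The flag is Im ∂ + Im ∂̄ ⊆ Ker d + Im ∂ + Im ∂̄ ⊆ Ker ∂∂̄. Its top quotient is carried by d to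
the defect of the ∂∂̄-lemma in degree `k + 1`; the bottom one is rewritten by the second isomorphism
theorem. -/
lemma relRank_aeppli (k : ℕ) :
    relRank (LinearMap.ker (del (k + 1) ∘ₗ delbar k)) (imDeg del k ⊔ imDeg delbar k) =
      relRank (LinearMap.ker (del (k + 1)) ⊓ LinearMap.ker (delbar (k + 1)) ⊓
        imDeg (fun k => del k + delbar k) (k + 1)) (imDegTwo del delbar (k + 1)) +
      relRank (LinearMap.ker (del k + delbar k))
        (LinearMap.ker (del k + delbar k) ⊓ (imDeg del k ⊔ imDeg delbar k)) := by
  rw [← h.relRank_ker_comp, ← relRank_sup]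
  exact relRank_eq_add le_sup_right (sup_le (h.ker_le_ker_comp k) (h.sup_le_ker_comp k))

/-- This flag and the one in `relRank_ker_eq_add_aeppli` are chosen so that each expansion of the
total cohomology shares a term with the Bott–Chern, respectively the Aeppli, dimension. -/
lemma relRank_ker_eq_add_bottChern (k : ℕ) :
    relRank (LinearMap.ker (del k + delbar k)) (imDeg (fun k => del k + delbar k) k) =
      relRank (LinearMap.ker (del k + delbar k)) (LinearMap.ker (del k) ⊓ LinearMap.ker (delbar k) ⊔
        imDeg (fun k => del k + delbar k) k) +
      relRank (LinearMap.ker (del k) ⊓ LinearMap.ker (delbar k))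
        (LinearMap.ker (del k) ⊓ LinearMap.ker (delbar k) ⊓
          imDeg (fun k => del k + delbar k) k) := by
  rw [← relRank_sup]
  exact relRank_eq_add le_sup_right (sup_le (inf_ker_le_ker k) (h.imDeg_le_ker k))

lemma relRank_ker_eq_add_aeppli (k : ℕ) :
    relRank (LinearMap.ker (del k + delbar k)) (imDeg (fun k => del k + delbar k) k) =
      relRank (LinearMap.ker (del k + delbar k))
        (LinearMap.ker (del k + delbar k) ⊓ (imDeg del k ⊔ imDeg delbar k)) +
      relRank (LinearMap.ker (del k + delbar k) ⊓ (imDeg del k ⊔ imDeg delbar k))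
        (imDeg (fun k => del k + delbar k) k) :=
  relRank_eq_add (le_inf (h.imDeg_le_ker k) (imDeg_le_sup k)) inf_le_left

/-- The inequality between the dimensions of the Bott-Chern, the Aeppli and the total cohomology
of a double complex. -/
theorem two_mul_relRank_le [CharZero 𝕜] (k : ℕ) :
    2 * relRank (LinearMap.ker (del k + delbar k)) (imDeg (fun k => del k + delbar k) k) ≤
      relRank (LinearMap.ker (del k) ⊓ LinearMap.ker (delbar k)) (imDegTwo del delbar k) +
      relRank (LinearMap.ker (del (k + 1) ∘ₗ delbar k)) (imDeg del k ⊔ imDeg delbar k) := by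
  rw [two_mul]
  -- The two copies of the total cohomology are expanded along different flags, one to be compared
  -- with the Bott–Chern and the other with the Aeppli dimension.
  nth_rw 1 [h.relRank_ker_eq_add_bottChern k]
  rw [h.relRank_ker_eq_add_aeppli k, h.relRank_bottChern k, h.relRank_aeppli k]
  refine (add_le_add (add_le_add_left (h.relRank_ker_le k) _)
    (add_le_add_right (h.relRank_inf_sup_le k) _)).trans_eq ?_
  ring

/-- Under the `∂∂̄`-lemma the inequality is an equality. -/
theorem relRank_add_eq_of_inf_eq [CharZero 𝕜]
    (hdd : ∀ k, LinearMap.ker (del k) ⊓ LinearMap.ker (delbar k) ⊓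
      imDeg (fun k => del k + delbar k) k = imDegTwo del delbar k) (k : ℕ) :
    relRank (LinearMap.ker (del k) ⊓ LinearMap.ker (delbar k)) (imDegTwo del delbar k) +
      relRank (LinearMap.ker (del (k + 1) ∘ₗ delbar k)) (imDeg del k ⊔ imDeg delbar k) =
    2 * relRank (LinearMap.ker (del k + delbar k)) (imDeg (fun k => del k + delbar k) k) := by
  refine le_antisymm ?_ (h.two_mul_relRank_le k)
  have h0 : ∀ k, relRank (LinearMap.ker (del k) ⊓ LinearMap.ker (delbar k) ⊓
      imDeg (fun k => del k + delbar k) k) (imDegTwo del delbar k) = 0 := fun k =>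
    relRank_eq_zero_iff.2 (hdd k).le
  rw [two_mul]
  nth_rw 1 [h.relRank_ker_eq_add_bottChern k]
  rw [h.relRank_ker_eq_add_aeppli k, h.relRank_bottChern k, h.relRank_aeppli k, h0, h0, add_zero,
    zero_add]
  -- Without the defects each of the two dimensions on the left is a single summand of one copy of
  -- the total cohomology, so no cancellation of cardinals is involved.
  exact add_le_add le_add_self le_self_add

/-- If the inequality is an equality of finite dimensions in all degrees then the `∂∂̄`-lemma
holds. -/
theorem inf_eq_of_relRank_add_eq [CharZero 𝕜]
    (hfin : ∀ k, relRank (LinearMap.ker (del k + delbar k))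
      (imDeg (fun k => del k + delbar k) k) < Cardinal.aleph0)
    (heq : ∀ k, relRank (LinearMap.ker (del k) ⊓ LinearMap.ker (delbar k))
        (imDegTwo del delbar k) +
      relRank (LinearMap.ker (del (k + 1) ∘ₗ delbar k)) (imDeg del k ⊔ imDeg delbar k) =
    2 * relRank (LinearMap.ker (del k + delbar k)) (imDeg (fun k => del k + delbar k) k)) (k : ℕ) :
    LinearMap.ker (del k) ⊓ LinearMap.ker (delbar k) ⊓
      imDeg (fun k => del k + delbar k) k = imDegTwo del delbar k := by
  refine le_antisymm ?_ (le_inf (h.imDegTwo_le_ker k) (h.imDegTwo_le_imDeg k))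
  -- In the notation introduced below, b = c₁ + c₂ = c₃ + c₄ and c₂ + c₅ + c₆ + c₃ = 2b, so c₅ + c₆
  -- = c₁ + c₄. As c₁ ≤ c₆ and c₄ ≤ c₅, both are equalities. The upper bound 2b also makes every
  -- term finite.
  have hall : ∀ k, relRank (LinearMap.ker (del k) ⊓ LinearMap.ker (delbar k) ⊓
        imDeg (fun k => del k + delbar k) k) (imDegTwo del delbar k) < Cardinal.aleph0 ∧
      relRank (LinearMap.ker (del (k + 1)) ⊓ LinearMap.ker (delbar (k + 1)) ⊓
        imDeg (fun k => del k + delbar k) (k + 1)) (imDegTwo del delbar (k + 1)) ≤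
      relRank (LinearMap.ker (del k + delbar k))
        (LinearMap.ker (del k) ⊓ LinearMap.ker (delbar k) ⊔
          imDeg (fun k => del k + delbar k) k) ∧
      relRank (LinearMap.ker (del k) ⊓ LinearMap.ker (delbar k) ⊓
        imDeg (fun k => del k + delbar k) k) (imDegTwo del delbar k) ≤
      relRank (LinearMap.ker (del k + delbar k) ⊓ (imDeg del k ⊔ imDeg delbar k))
        (imDeg (fun k => del k + delbar k) k) := by
    intro k
    have e1 := hfin k
    have e2 := heq k
    have e3 := h.relRank_ker_le k
    have e4 := h.relRank_inf_sup_le k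
    have e5 := h.relRank_ker_eq_add_bottChern k
    have e6 := h.relRank_ker_eq_add_aeppli k
    rw [h.relRank_bottChern k, h.relRank_aeppli k] at e2
    generalize relRank (LinearMap.ker (del k + delbar k))
      (imDeg (fun k => del k + delbar k) k) = b at *
    generalize relRank (LinearMap.ker (del k + delbar k))
        (LinearMap.ker (del k) ⊓ LinearMap.ker (delbar k) ⊔
          imDeg (fun k => del k + delbar k) k) = c₁ at *
    generalize relRank (LinearMap.ker (del k) ⊓ LinearMap.ker (delbar k))
        (LinearMap.ker (del k) ⊓ LinearMap.ker (delbar k) ⊓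
          imDeg (fun k => del k + delbar k) k) = c₂ at *
    generalize relRank (LinearMap.ker (del k + delbar k))
        (LinearMap.ker (del k + delbar k) ⊓ (imDeg del k ⊔ imDeg delbar k)) = c₃ at *
    generalize relRank (LinearMap.ker (del k + delbar k) ⊓ (imDeg del k ⊔ imDeg delbar k))
        (imDeg (fun k => del k + delbar k) k) = c₄ at *
    generalize relRank (LinearMap.ker (del k) ⊓ LinearMap.ker (delbar k) ⊓
        imDeg (fun k => del k + delbar k) k) (imDegTwo del delbar k) = c₅ at *
    generalize relRank (LinearMap.ker (del (k + 1)) ⊓ LinearMap.ker (delbar (k + 1)) ⊓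
        imDeg (fun k => del k + delbar k) (k + 1)) (imDegTwo del delbar (k + 1)) = c₆ at *
    lift b to ℕ using e1
    have f1 : c₂ + c₅ + (c₆ + c₃) < Cardinal.aleph0 := by
      rw [e2]; exact_mod_cast Cardinal.natCast_lt_aleph0 (n := 2 * b)
    simp only [Cardinal.add_lt_aleph0_iff] at f1
    obtain ⟨⟨f2, f5⟩, f6, f3⟩ := f1
    have f14 := (e3.trans_lt f6)
    have f4 := (e4.trans_lt f5)
    lift c₁ to ℕ using f14
    lift c₂ to ℕ using f2
    lift c₃ to ℕ using f3
    lift c₄ to ℕ using f4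
    lift c₅ to ℕ using f5
    lift c₆ to ℕ using f6
    norm_cast at *
    refine ⟨Cardinal.natCast_lt_aleph0, ?_, ?_⟩ <;> omega
  match k with
  | 0 => exact inf_le_right
  | k + 1 =>
    -- The goal becomes Ker ∂∂̄ ⊆ Ker d + Im ∂ + Im ∂̄ in degree `k`.
    rw [← relRank_eq_zero_iff, ← h.relRank_ker_comp, relRank_eq_zero_iff]
    have hsurj := exists_sub_mem_of_relRank_le (del k ∘ₗ sgn π k)
      (fun _ hz => h.del_sgn_mem_inf hz) (fun _ hz hq => h.mem_sup_of_del_sgn_mem hz hq)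
      (le_inf (h.imDegTwo_le_ker (k + 1)) (h.imDegTwo_le_imDeg (k + 1))) (hall (k + 1)).1
      (hall k).2.1
    have hinj := mem_of_relRank_le (del k ∘ₗ sgn π k) (fun _ hx => h.del_sgn_mem_inf_sup hx)
      (fun _ _ hx => h.del_sgn_mem_imDeg hx) (fun _ hy => h.exists_sub_del_sgn_mem hy)
      (sup_le (h.ker_le_ker_comp k) (h.sup_le_ker_comp k))
      ((h.relRank_ker_comp k).trans_lt (hall (k + 1)).1)
      ((h.relRank_ker_comp k).trans_le (hall (k + 1)).2.2)
    intro r hr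
    refine hinj r hr ?_
    have hdr : (del k + delbar k) r ∈ LinearMap.ker (del (k + 1)) ⊓
        LinearMap.ker (delbar (k + 1)) ⊓ imDeg (fun k => del k + delbar k) (k + 1) := by
      rw [LinearMap.mem_ker, LinearMap.comp_apply] at hr
      exact ⟨⟨by simp [h.del_del, hr], by simp [h.delbar_del, h.delbar_delbar, hr]⟩, r, rfl⟩
    -- dr agrees with ∂Tz = d(Tz/2) modulo Im ∂∂̄, for some closed z.
    obtain ⟨z, hz, hq⟩ := hsurj _ hdr
    have hz2 : del k (sgn π k z) = (del k + delbar k) ((2 : 𝕜)⁻¹ • sgn π k z) := by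
      rw [map_smul, ← h.two_smul_del_sgn hz, smul_smul, inv_mul_cancel₀ two_ne_zero, one_smul]
    -- `r - Tz / 2` is closed modulo the images of `∂` and `∂̄`
    have hu : r - (2 : 𝕜)⁻¹ • sgn π k z ∈
        LinearMap.ker (del k + delbar k) ⊔ (imDeg del k ⊔ imDeg delbar k) := by
      rw [LinearMap.comp_apply, hz2, ← map_sub] at hq
      generalize r - (2 : 𝕜)⁻¹ • sgn π k z = s at hq ⊢
      clear * - hq h
      match k with
      | 0 => exact Submodule.mem_sup_left hq
      | k + 1 =>
        obtain ⟨y, hy⟩ := hq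
        have h1 : s - delbar k y ∈ LinearMap.ker (del (k + 1) + delbar (k + 1)) := by
          rw [LinearMap.mem_ker, map_sub, ← hy]
          simp [h.delbar_delbar]
        have h2 := Submodule.add_mem_sup h1 (Submodule.mem_sup_right ⟨y, rfl⟩ :
          delbar k y ∈ imDeg del (k + 1) ⊔ imDeg delbar (k + 1))
        rwa [sub_add_cancel] at h2
    -- Since T² = 1, this says that ∂Tr - ∂z/2 is exact. The weight operator shows that ∂z is exact,
    -- hence so is ∂Tr, as `hinj` requires.
    have h1 := h.del_sgn_mem_imDeg hu
    rw [map_sub, map_sub, map_smul, map_smul, h.sgn_sgn] at h1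
    have h2 : del k z ∈ imDeg (fun k => del k + delbar k) (k + 1) := h.del_mem_of_closed hz
    have h3 := Submodule.add_mem _ h1 (Submodule.smul_mem _ (2 : 𝕜)⁻¹ h2)
    rwa [sub_add_cancel] at h3

/-! ### Finiteness of the total cohomology -/

lemma exists_proj_sub_eq_zero {k m : ℕ} {y : A k} (hy : ∀ p < m, π k p y = 0)
    (hπ : π k m y ∈ imDeg delbar k) :
    ∃ b ∈ imDeg (fun k => del k + delbar k) k, ∀ p < m + 1, π k p (y - b) = 0 := by
  match k with
  | 0 =>
    refine ⟨0, Submodule.zero_mem _, fun p hp => ?_⟩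
    rw [sub_zero]
    rcases Nat.lt_succ_iff_lt_or_eq.1 hp with hp | rfl
    · exact hy p hp
    · exact hπ
  | k + 1 =>
    obtain ⟨b, hb⟩ := hπ
    have hb' : delbar k (π k m b) = π (k + 1) m y := by
      rw [h.delbar_proj, hb, h.proj_proj, if_pos rfl]
    -- Keeping only the part of index `m` of `b`, its differential has parts of index `m` and `m +
    -- 1` only: it cancels the part of index `m` of `y` and leaves those below it zero.
    refine ⟨(del k + delbar k) (π k m b), ⟨_, rfl⟩, fun p hp => ?_⟩
    rw [LinearMap.add_apply, hb', h.del_proj, map_sub, map_add, h.proj_proj, h.proj_proj,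
      if_neg (by omega), zero_add]
    rcases Nat.lt_succ_iff_lt_or_eq.1 hp with hp | rfl
    · rw [if_neg (by omega), hy p hp, sub_zero]
    · rw [if_pos rfl, sub_self]

/-- The dimension of the total cohomology is finite if those of the `∂̄`-cohomology are. -/
theorem relRank_ker_lt_aleph0 (k : ℕ)
    (hfin : ∀ p ≤ k, relRank (LinearMap.range (π k p) ⊓ LinearMap.ker (delbar k))
      (imDeg delbar k) < Cardinal.aleph0) :
    relRank (LinearMap.ker (del k + delbar k)) (imDeg (fun k => del k + delbar k) k) <
      Cardinal.aleph0 := by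
  let Z : ℕ → Submodule 𝕜 (A k) := fun m =>
    LinearMap.ker (del k + delbar k) ⊓ ⨅ p < m, LinearMap.ker (π k p)
  have hZ : ∀ m x, x ∈ Z m ↔ del k x + delbar k x = 0 ∧ ∀ p < m, π k p x = 0 := by
    intro m x
    simp [Z, Submodule.mem_iInf]
  -- Descending induction on the filtration step `m`, starting at `m = k + 1`, where no parts are
  -- left.
  have key : ∀ j m, m + j = k + 1 → ∃ W : Submodule 𝕜 (A k), FiniteDimensional 𝕜 W ∧
      Z m ≤ W ⊔ imDeg (fun k => del k + delbar k) k := by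
    intro j
    induction j with
    | zero =>
      intro m hm
      refine ⟨⊥, inferInstance, fun x hx => ?_⟩
      have : x = 0 := by
        rw [← h.sum_proj k x]
        refine Finset.sum_eq_zero fun p hp => ((hZ m x).1 hx).2 p ?_
        have := Finset.mem_range.1 hp
        omega
      rw [this]
      exact Submodule.zero_mem _
    | succ j ih =>
      intro m hm
      obtain ⟨W, hW, hle⟩ := ih (m + 1) (by omega)
      -- The part of index `m` of dx = 0 is ∂̄ of the leading part plus ∂ of the part of index `m -
      -- 1`, which vanishes.
      have hproj : ∀ x ∈ Z m,
          π k m x ∈ LinearMap.range (π k m) ⊓ LinearMap.ker (delbar k) := by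
        intro x hx
        obtain ⟨h1, h2⟩ := (hZ m x).1 hx
        refine ⟨⟨x, rfl⟩, ?_⟩
        have h3 := congrArg (π (k + 1) m) h1
        rw [map_add, map_zero] at h3
        have h4 : π (k + 1) m (del k x) = 0 := by
          rcases m with _ | m
          · exact h.proj_zero_del k x
          · rw [← h.del_proj, h2 m (Nat.lt_succ_self m), map_zero]
        rw [h4, zero_add] at h3
        rw [SetLike.mem_coe, LinearMap.mem_ker, h.delbar_proj, h3]
      let D := LinearMap.range (π k m) ⊓ LinearMap.ker (delbar k)
      let φ : Z m →ₗ[𝕜] D ⧸ (imDeg delbar k).submoduleOf D :=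
        ((imDeg delbar k).submoduleOf D).mkQ ∘ₗ (π k m).restrict hproj
      have : FiniteDimensional 𝕜 (D ⧸ (imDeg delbar k).submoduleOf D) :=
        Module.rank_lt_aleph0_iff.1 (hfin m (by omega))
      -- `s` lifts the Dolbeault classes which are leading parts of closed elements of `Z m`.
      -- Subtracting such a lift makes the leading part ∂̄-exact, and an exact correction then moves
      -- the element into `Z (m + 1)`.
      obtain ⟨s, hs⟩ := φ.rangeRestrict.exists_rightInverse_of_surjective φ.range_rangeRestrict
      refine ⟨LinearMap.range ((Z m).subtype ∘ₗ s) ⊔ W, inferInstance, fun x hx => ?_⟩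
      have hker : ∀ y ∈ Z m, π k m y ∈ imDeg delbar k →
          y ∈ Z (m + 1) ⊔ imDeg (fun k => del k + delbar k) k := by
        intro y hy hπ
        obtain ⟨h1, h2⟩ := (hZ m y).1 hy
        obtain ⟨b, hb, hyb⟩ := h.exists_proj_sub_eq_zero h2 hπ
        have h3 : y - b ∈ Z (m + 1) :=
          (hZ _ _).2 ⟨Submodule.sub_mem _ (LinearMap.mem_ker.2 h1) (h.imDeg_le_ker k hb), hyb⟩
        have h4 := Submodule.add_mem_sup h3 hb
        rwa [sub_add_cancel] at h4
      set x' : Z m := ⟨x, hx⟩ with hx'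
      set y : Z m := s (φ.rangeRestrict x') with hy
      have h1 : φ y = φ x' := congrArg Subtype.val (LinearMap.congr_fun hs (φ.rangeRestrict x'))
      have h2 : φ (x' - y) = 0 := by rw [map_sub, h1, sub_self]
      have h3 : π k m (x' - y : Z m) ∈ imDeg delbar k :=
        (Submodule.Quotient.mk_eq_zero ((imDeg delbar k).submoduleOf D)).1 h2
      have h4 : ((x' - y : Z m) : A k) ∈ W ⊔ imDeg (fun k => del k + delbar k) k :=
        (sup_le hle le_sup_right) (hker _ (x' - y).2 h3)
      have h5 : (y : A k) ∈ LinearMap.range ((Z m).subtype ∘ₗ s) := ⟨_, rfl⟩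
      rw [sup_assoc]
      have h6 := Submodule.add_mem_sup h5 h4
      simpa [hx'] using h6
  obtain ⟨W, hW, hle⟩ := key (k + 1) 0 (zero_add _)
  have h0 : LinearMap.ker (del k + delbar k) ≤ Z 0 := fun x hx => (hZ 0 x).2 ⟨hx, by simp⟩
  refine (relRank_mono_left _ (h0.trans hle)).trans_lt ?_
  rw [relRank_sup]
  exact (rank_quotient_le _).trans_lt (Module.rank_lt_aleph0 𝕜 W)

end IsDoubleComplex

end DoubleComplexes

/-! ### Types of real multilinear forms on a complex vector space -/

section TypeDecomposition
variable {F : Type*} [NormedAddCommGroup F] [NormedSpace ℂ F] {k : ℕ}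

/-- A real linear map is the sum of its complex linear and antilinear parts, (D(v) ∓ iD(iv))/2. -/
lemma real_linear_smul {V : Type*} [AddCommGroup V] [Module ℂ V] (D : V →ₗ[ℝ] ℂ) (c : ℂ) (v : V) :
    D (c • v) = c * ((D v - Complex.I * D (Complex.I • v)) / 2) +
      starRingEnd ℂ c * ((D v + Complex.I * D (Complex.I • v)) / 2) := by
  have h : c • v = c.re • v + c.im • (Complex.I • v) := by
    conv_lhs => rw [← Complex.re_add_im c, add_smul, mul_smul]
    simp only [Complex.coe_smul]
  rw [h, map_add, map_smul, map_smul, Complex.real_smul, Complex.real_smul]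
  have h1 : (c.re : ℂ) = (c + starRingEnd ℂ c) / 2 := by
    rw [Complex.add_conj]; push_cast; ring
  have h2 : (c.im : ℂ) = -Complex.I * (c - starRingEnd ℂ c) / 2 := by
    rw [Complex.sub_conj]
    push_cast
    linear_combination (c.im : ℂ) * Complex.I_sq
  rw [h1, h2]
  ring

/-- A real multilinear map is a sum of parts homogeneous of the types `(p, k - p)`. -/
lemma exists_homogeneous_parts (m : MultilinearMap ℝ (fun _ : Fin k => F) ℂ) (v : Fin k → F) :
    ∃ a : ℕ → ℂ, ∀ c : ℂ, m (fun j => c • v j) =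
      ∑ p ∈ Finset.range (k + 1), c ^ p * (starRingEnd ℂ c) ^ (k - p) * a p := by
  induction k with
  | zero =>
    refine ⟨fun _ => m v, fun c => ?_⟩
    rw [Finset.sum_range_one]
    simp only [pow_zero, Nat.sub_zero, one_mul]
    exact congrArg m (funext fun j => j.elim0)
  | succ k ih =>
    obtain ⟨a, ha⟩ := ih (m.curryLeft (v 0)) (Fin.tail v)
    obtain ⟨b, hb⟩ := ih (m.curryLeft (Complex.I • v 0)) (Fin.tail v)
    -- The first argument contributes a factor c through its linear part, raising `p - 1` to `p`, or
    -- c̄ through its antilinear part. The cases `p = 0` and `p = k + 1` exclude the missing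
    -- contribution.
    refine ⟨fun p => (if p = 0 then 0 else (a (p - 1) - Complex.I * b (p - 1)) / 2) +
      (if p = k + 1 then 0 else (a p + Complex.I * b p) / 2), fun c => ?_⟩
    have h0 : (fun j => c • v j) = Fin.cons (c • v 0) (fun j => c • Fin.tail v j) := by
      funext j
      refine Fin.cases rfl (fun j => rfl) j
    let D : F →ₗ[ℝ] ℂ :=
      { toFun := fun u => m.curryLeft u (fun j => c • Fin.tail v j)
        map_add' := fun x y => by rw [map_add]; rfl
        map_smul' := fun x y => by rw [map_smul]; rfl }
    have h1 : m (fun j => c • v j) = D (c • v 0) := by rw [h0]; rfl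
    have h2 : D (v 0) = _ := ha c
    have h3 : D (Complex.I • v 0) = _ := hb c
    have e1 : c * ((D (v 0) - Complex.I * D (Complex.I • v 0)) / 2) =
        ∑ p ∈ Finset.range (k + 1), c ^ (p + 1) * (starRingEnd ℂ c) ^ (k - p) *
          ((a p - Complex.I * b p) / 2) := by
      rw [h2, h3, Finset.mul_sum, ← Finset.sum_sub_distrib, Finset.sum_div, Finset.mul_sum]
      exact Finset.sum_congr rfl fun p _ => by ring
    have e2 : starRingEnd ℂ c * ((D (v 0) + Complex.I * D (Complex.I • v 0)) / 2) =
        ∑ p ∈ Finset.range (k + 1), c ^ p * (starRingEnd ℂ c) ^ (k - p + 1) *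
          ((a p + Complex.I * b p) / 2) := by
      rw [h2, h3, Finset.mul_sum, ← Finset.sum_add_distrib, Finset.sum_div, Finset.mul_sum]
      exact Finset.sum_congr rfl fun p _ => by ring
    rw [h1, real_linear_smul, e1, e2]
    simp_rw [mul_add (_ ^ _ * _), Finset.sum_add_distrib]
    congr 1
    · rw [Finset.sum_range_succ' _ (k + 1)]
      simp
    · rw [Finset.sum_range_succ _ (k + 1), if_pos rfl, mul_zero, add_zero]
      refine Finset.sum_congr rfl fun p hp => ?_
      have hp' := Finset.mem_range.1 hp
      rw [if_neg (by omega), show k + 1 - p = k - p + 1 by omega]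

/-- Orthogonality of the characters `c ^ p * conj c ^ (k - p)` on the roots of unity. -/
lemma average_roots_of_unity {p p' : ℕ} (hp : p ≤ k) (hp' : p' ≤ k) :
    ((2 * k + 1 : ℕ) : ℂ)⁻¹ * ∑ m ∈ Finset.range (2 * k + 1),
      (let c : ℂ := Complex.exp (2 * Real.pi * Complex.I / (2 * k + 1 : ℕ)) ^ m
      starRingEnd ℂ (c ^ p * (starRingEnd ℂ c) ^ (k - p)) *
        (c ^ p' * (starRingEnd ℂ c) ^ (k - p'))) = if p = p' then 1 else 0 := by
  set N := 2 * k + 1 with hN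
  set ζ : ℂ := Complex.exp (2 * Real.pi * Complex.I / (N : ℕ)) with hζ
  have hprim : IsPrimitiveRoot ζ N := Complex.isPrimitiveRoot_exp N (by omega)
  have hnorm : ‖ζ‖ = 1 := hprim.norm'_eq_one (by omega)
  have hz0 : ζ ≠ 0 := hprim.ne_zero (by omega)
  have hc : starRingEnd ℂ ζ = ζ⁻¹ := by
    refine eq_inv_of_mul_eq_one_right ?_
    rw [Complex.mul_conj, Complex.normSq_eq_norm_sq, hnorm]; simp
  have hterm : ∀ m ∈ Finset.range N, (let c : ℂ := ζ ^ m
      starRingEnd ℂ (c ^ p * (starRingEnd ℂ c) ^ (k - p)) *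
        (c ^ p' * (starRingEnd ℂ c) ^ (k - p'))) = (ζ ^ (2 * (p' : ℤ) - 2 * p)) ^ m := by
    intro m _
    simp only [map_mul, map_pow, hc, map_inv₀, inv_inv]
    simp only [← zpow_natCast, inv_zpow', ← zpow_mul, ← zpow_add₀ hz0]
    congr 1
    push_cast [hp, hp']
    ring
  rw [Finset.sum_congr rfl hterm]
  split_ifs with h
  · subst h
    have : (N : ℂ) ≠ 0 := Nat.cast_ne_zero.2 (by omega)
    simp [this]
  · have hne : ζ ^ (2 * (p' : ℤ) - 2 * p) ≠ 1 := by
      intro h1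
      have h2 := (hprim.zpow_eq_one_iff_dvd _).1 h1
      -- The exponent has absolute value at most `2 * k`, which is less than the order `N = 2 * k +
      -- 1`; this is why the average runs over that many roots.
      have h3 := Int.eq_zero_of_abs_lt_dvd h2
        (by rw [abs_lt]; constructor <;> push_cast [hN] <;> omega)
      omega
    have hpow : (ζ ^ (2 * (p' : ℤ) - 2 * p)) ^ N = 1 := by
      rw [← zpow_natCast, ← zpow_mul, mul_comm, zpow_mul, zpow_natCast, hprim.pow_eq_one,
        one_zpow]
    rw [geom_sum_eq hne, hpow]
    simp

/-- The exterior derivative of a form of type `(p, q)` on a complex vector space has only parts of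
the types `(p + 1, q)` and `(p, q + 1)`. -/
lemma extDeriv_smul_of_type {b : F → F [⋀^Fin k]→L[ℝ] ℂ} {t : F} {p q : ℕ}
    (hb : DifferentiableAt ℝ b t)
    (h : ∀ᶠ t' in 𝓝 t, ∀ (c : ℂ) (w : Fin k → F),
      b t' (fun j => c • w j) = c ^ p * (starRingEnd ℂ c) ^ q * b t' w) (u : Fin (k + 1) → F) :
    ∃ X Y : ℂ, ∀ c : ℂ, extDeriv b t (fun j => c • u j) =
      c ^ (p + 1) * (starRingEnd ℂ c) ^ q * X + c ^ p * (starRingEnd ℂ c) ^ (q + 1) * Y := by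
  let D : Fin (k + 1) → F →L[ℝ] ℂ := fun i => fderiv ℝ (fun z => b z (i.removeNth u)) t
  refine ⟨∑ i : Fin (k + 1), (-1) ^ (i : ℕ) * ((D i (u i) - Complex.I * D i (Complex.I • u i)) / 2),
    ∑ i : Fin (k + 1), (-1) ^ (i : ℕ) * ((D i (u i) + Complex.I * D i (Complex.I • u i)) / 2), fun c => ?_⟩
  rw [extDeriv_apply hb, Finset.mul_sum, Finset.mul_sum, ← Finset.sum_add_distrib]
  refine Finset.sum_congr rfl fun i _ => ?_
  -- Homogeneity of the coefficients near `t` passes to their derivative. The direction of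
  -- differentiation supplies the one extra factor c or c̄.
  have h1 : fderiv ℝ (fun z => b z (i.removeNth fun j => c • u j)) t =
      (c ^ p * (starRingEnd ℂ c) ^ q) • D i := by
    have h2 : (fun z => b z (i.removeNth fun j => c • u j)) =ᶠ[𝓝 t]
        fun z => (c ^ p * (starRingEnd ℂ c) ^ q) • b z (i.removeNth u) :=
      h.mono fun z hz => hz c (i.removeNth u)
    rw [h2.fderiv_eq]
    have h3 : DifferentiableAt ℝ (fun z => b z (i.removeNth u)) t :=
      hb.continuousAlternatingMap_apply_const _
    exact fderiv_const_smul h3 (c ^ p * (starRingEnd ℂ c) ^ q)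
  rw [h1]
  have h3 : ((c ^ p * (starRingEnd ℂ c) ^ q) • D i) (c • u i) =
      c ^ p * (starRingEnd ℂ c) ^ q * (D i).toLinearMap (c • u i) := rfl
  rw [h3, real_linear_smul]
  simp only [ContinuousLinearMap.coe_coe, zsmul_eq_mul]
  push_cast
  ring

end TypeDecomposition

/-! ### Type decomposition of basic forms -/

namespace TransverselyHolomorphicFoliation
variable {E : Type*} [NormedAddCommGroup E] [NormedSpace ℝ E]
  {M : Type*} [TopologicalSpace M] [ChartedSpace E M]
  {F : Type*} [NormedAddCommGroup F] [NormedSpace ℂ F]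
  {T : Type*} [TopologicalSpace T] [ChartedSpace F T] {ι : Type*} {k : ℕ}
  (𝓕 : TransverselyHolomorphicFoliation E M F T ι)
  [IsManifold 𝓘(ℝ, E) ∞ M] [IsManifold 𝓘(ℂ, F) ω T]

lemma surjective_fderiv_localMap {i : ι} {x₀ : M} {t₀ : T} {y : E}
    (hy : y ∈ 𝓕.localDomain i x₀ t₀) :
    Function.Surjective (fderiv ℝ (𝓕.localMap i x₀ t₀) y) := by
  intro u
  obtain ⟨A, hA, h⟩ := 𝓕.exists_fderiv_localMap hy
  obtain ⟨u', rfl⟩ := hA.2 u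
  obtain ⟨w, rfl⟩ := 𝓕.submersion_f i _ hy.2.1 u'
  obtain ⟨v, rfl⟩ := exists_lift_chart hy.1 w
  exact ⟨v, h v⟩

/-- A local form on the transverse manifold which represents a basic form of type `(p, q)` is of
type `(p, q)` at the points which come from `M`. -/
lemma local_form_smul {p q : ℕ} {α : 𝓕.basicForms k} (hα : α ∈ 𝓕.typeForms k p q) {i : ι}
    {x₀ : M} {t₀ : T} {y : E} (hy : y ∈ 𝓕.localDomain i x₀ t₀) {b : F [⋀^Fin k]→L[ℝ] ℂ}
    (hb : chartRep x₀ α.1 y = b.compContinuousLinearMap (fderiv ℝ (𝓕.localMap i x₀ t₀) y))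
    (hs : Function.Surjective (fderiv ℝ (𝓕.localMap i x₀ t₀) y)) (c : ℂ) (w : Fin k → F) :
    b (fun j => c • w j) = c ^ p * (starRingEnd ℂ c) ^ q * b w := by
  obtain ⟨A, hA, h⟩ := 𝓕.exists_fderiv_localMap hy
  choose v hv using fun j => hs (w j)
  choose v' hv' using fun j => hs (c • w j)
  have h1 : b w = chartRep x₀ α.1 y v := by
    rw [hb]; exact congrArg b (funext fun j => (hv j).symm)
  have h2 : b (fun j => c • w j) = chartRep x₀ α.1 y v' := by
    rw [hb]; exact congrArg b (funext fun j => (hv' j).symm)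
  rw [h1, h2]
  refine hα c i _ hy.2.1 _ _ fun j => hA.1 ?_
  refine ((h (v' j)).symm.trans (hv' j)).trans ?_
  rw [A.map_smul]
  exact congrArg (c • ·) ((h (v j)).symm.trans (hv j)).symm

variable [FiniteDimensional ℝ E] [FiniteDimensional ℂ F]

/-- A linear section of the surjective transverse differential turns the value of α at `x` into a
multilinear form on the complex space `F`, whose homogeneous parts are known. -/
lemma exists_scale_eq_sum (α : 𝓕.basicForms k) (x : M) (v : Fin k → TangentSpace 𝓘(ℝ, E) x) :
    ∃ a : ℕ → ℂ, ∀ c : ℂ, (𝓕.scale k c α).1 x v =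
      ∑ p ∈ Finset.range (k + 1), c ^ p * (starRingEnd ℂ c) ^ (k - p) * a p := by
  obtain ⟨i, hi⟩ := 𝓕.cover x
  obtain ⟨R, hR⟩ := (𝓕.transDeriv i x).toLinearMap.exists_rightInverse_of_surjective
    (LinearMap.range_eq_top.2 (𝓕.submersion_f i x hi))
  obtain ⟨a, ha⟩ := exists_homogeneous_parts
    ((α.1 x).toMultilinearMap.compLinearMap fun _ => R) (fun j => 𝓕.transDeriv i x (v j))
  refine ⟨a, fun c => ?_⟩
  rw [← ha c]
  exact 𝓕.scale_apply c α hi (w := fun j => R (c • 𝓕.transDeriv i x (v j)))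
    fun j => LinearMap.congr_fun hR _

/-- By orthogonality of the characters the average defining `typeProj` selects one coefficient. Any
expansion of this form may therefore be used to compute the projections, which is how the lemmas
below apply it. -/
lemma typeProj_apply_of_scale (α : 𝓕.basicForms k) {x : M}
    {v : Fin k → TangentSpace 𝓘(ℝ, E) x} {a : ℕ → ℂ}
    (h : ∀ c : ℂ, (𝓕.scale k c α).1 x v =
      ∑ p ∈ Finset.range (k + 1), c ^ p * (starRingEnd ℂ c) ^ (k - p) * a p)
    {p : ℕ} (hp : p ≤ k) : (𝓕.typeProj k p (k - p) α).1 x v = a p := by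
  let ev : 𝓕.basicForms k →ₗ[ℂ] ℂ :=
    { toFun := fun β => β.1 x v
      map_add' := fun _ _ => rfl
      map_smul' := fun _ _ => rfl }
  change ev (𝓕.typeProj k p (k - p) α) = a p
  have h' : ∀ c, ev (𝓕.scale k c α) =
      ∑ p ∈ Finset.range (k + 1), c ^ p * (starRingEnd ℂ c) ^ (k - p) * a p := h
  rw [typeProj, if_pos (by omega)]
  simp only [LinearMap.smul_apply, LinearMap.sum_apply, map_smul, map_sum, h', smul_eq_mul,
    Finset.mul_sum]
  rw [Finset.sum_comm, Finset.sum_eq_single p]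
  · have h1 := congrArg (· * a p) (average_roots_of_unity hp hp)
    simp only [if_true, one_mul, Finset.mul_sum, Finset.sum_mul] at h1
    refine Eq.trans (Finset.sum_congr rfl fun m _ => ?_) h1
    ring
  · intro p' hp' hne
    have hp'' : p' ≤ k := by have := Finset.mem_range.1 hp'; omega
    have h1 := congrArg (· * a p') (average_roots_of_unity hp hp'')
    simp only [if_neg hne.symm, zero_mul, Finset.mul_sum, Finset.sum_mul] at h1
    refine Eq.trans (Finset.sum_congr rfl fun m _ => ?_) h1
    ring
  · intro hn
    exact absurd (Finset.mem_range.2 (by omega)) hn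

lemma sum_typeProj (α : 𝓕.basicForms k) :
    ∑ p ∈ Finset.range (k + 1), 𝓕.typeProj k p (k - p) α = α := by
  refine Subtype.ext (funext fun x => ?_)
  ext v
  let ev : 𝓕.basicForms k →ₗ[ℂ] ℂ :=
    { toFun := fun β => β.1 x v
      map_add' := fun _ _ => rfl
      map_smul' := fun _ _ => rfl }
  obtain ⟨a, ha⟩ := 𝓕.exists_scale_eq_sum α x v
  obtain ⟨i, hi⟩ := 𝓕.cover x
  change ev _ = ev α
  rw [map_sum]
  have h1 : ∀ p ∈ Finset.range (k + 1), ev (𝓕.typeProj k p (k - p) α) = a p := fun p hp =>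
    𝓕.typeProj_apply_of_scale α ha (Nat.lt_succ_iff.1 (Finset.mem_range.1 hp))
  -- At c = 1 the expansion is just the sum of its coefficients.
  have h2 : ev (𝓕.scale k 1 α) = ev α := 𝓕.scale_apply 1 α hi fun j => (one_smul ℂ _).symm
  have h3 : ev (𝓕.scale k 1 α) = _ := ha 1
  rw [Finset.sum_congr rfl h1, ← h2, h3]
  simp

lemma typeProj_mem (α : 𝓕.basicForms k) {p : ℕ} (hp : p ≤ k) :
    𝓕.typeProj k p (k - p) α ∈ 𝓕.typeForms k p (k - p) := by
  intro c i x hx v w hvw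
  obtain ⟨a, ha⟩ := 𝓕.exists_scale_eq_sum α x v
  rw [𝓕.typeProj_apply_of_scale α ha hp]
  refine 𝓕.typeProj_apply_of_scale α
    (a := fun p => c ^ p * (starRingEnd ℂ c) ^ (k - p) * a p) (fun c' => ?_) hp
  -- Passing from `v` to `w` replaces c' by c'c in the expansion, so each coefficient is multiplied
  -- by its own character at c.
  have h1 : (𝓕.scale k c' α).1 x w = (𝓕.scale k (c' * c) α).1 x v := by
    refine (𝓕.scale_apply (c' * c) α hx fun j => ?_).symm
    refine (𝓕.transDeriv_lift c' hx (w j)).trans ?_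
    rw [hvw, smul_smul]
  rw [h1, ha]
  refine Finset.sum_congr rfl fun p _ => ?_
  rw [map_mul, mul_pow, mul_pow]
  ring

lemma typeProj_typeProj {p q : ℕ} (hp : p ≤ k) (hq : q ≤ k) (α : 𝓕.basicForms k) :
    𝓕.typeProj k p (k - p) (𝓕.typeProj k q (k - q) α) =
      if p = q then 𝓕.typeProj k p (k - p) α else 0 := by
  rw [𝓕.typeProj_of_mem (by omega) (by omega) (𝓕.typeProj_mem α hq)]
  split_ifs with h
  · rw [h]
  · rfl

lemma range_typeProj {p : ℕ} (hp : p ≤ k) :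
    LinearMap.range (𝓕.typeProj k p (k - p)) = 𝓕.typeForms k p (k - p) := by
  refine le_antisymm ?_ fun α hα => ⟨α, ?_⟩
  · rintro _ ⟨α, rfl⟩
    exact 𝓕.typeProj_mem α hp
  · rw [𝓕.typeProj_of_mem (by omega) (by omega) hα, if_pos rfl]

/-- Locally α is the pullback of a form `b` on the model space `F`, d commutes with pullback, and
the transverse differential in charts is complex linear on the normal space; this reduces the claim
to `extDeriv_smul_of_type` for `b`. -/
lemma exists_scale_d_eq {p q : ℕ} {α : 𝓕.basicForms k} (hα : α ∈ 𝓕.typeForms k p q) (x : M)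
    (v : Fin (k + 1) → TangentSpace 𝓘(ℝ, E) x) :
    ∃ X Y : ℂ, ∀ c : ℂ, (𝓕.scale (k + 1) c (𝓕.d k α)).1 x v =
      c ^ (p + 1) * (starRingEnd ℂ c) ^ q * X + c ^ p * (starRingEnd ℂ c) ^ (q + 1) * Y := by
  have : FiniteDimensional ℝ F := FiniteDimensional.complexToReal F
  have : CompleteSpace E := FiniteDimensional.complete ℝ E
  have : CompleteSpace F := FiniteDimensional.complete ℝ F
  obtain ⟨i, hx⟩ := 𝓕.cover x
  have hxs : (extChartAt 𝓘(ℝ, E) x).symm (extChartAt 𝓘(ℝ, E) x x) = x := extChartAt_to_inv x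
  set y₀ := extChartAt 𝓘(ℝ, E) x x with hy₀
  set t₀ := 𝓕.f i ((extChartAt 𝓘(ℝ, E) x).symm y₀) with ht₀
  have hdom : y₀ ∈ 𝓕.localDomain i x t₀ :=
    ⟨mem_extChartAt_target x, by rw [Set.mem_preimage, hxs]; exact ⟨hx, by
      rw [Set.mem_preimage, ht₀, hxs]; exact mem_extChartAt_source _⟩⟩
  obtain ⟨b, V, W', hV, hW', hyW', hsub, hmaps, hb, hrep⟩ := 𝓕.exists_local_form α hdom
  set g := 𝓕.localMap i x t₀ with hg'
  have hg : ContDiffOn ℝ ∞ g W' := (𝓕.contDiffOn_localMap i x t₀).mono hsub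
  have hgat : ContDiffAt ℝ ∞ g y₀ := hg.contDiffAt (hW'.mem_nhds hyW')
  have hbd : DifferentiableAt ℝ b (g y₀) :=
    (hb.contDiffAt (hV.mem_nhds (hmaps hyW'))).differentiableAt (by simp)
  -- The type of `b` is known only at points in the image of `g`. As `g` is a submersion, these fill
  -- a neighbourhood of `g y₀`, so `b` may be differentiated there.
  have htype : ∀ᶠ t in 𝓝 (g y₀), ∀ (c : ℂ) (w : Fin k → F),
      b t (fun j => c • w j) = c ^ p * (starRingEnd ℂ c) ^ q * b t w := by
    have hstrict : HasStrictFDerivAt g (fderiv ℝ g y₀) y₀ := hgat.hasStrictFDerivAt (by simp)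
    rw [← hstrict.map_nhds_eq_of_surj
      (LinearMap.range_eq_top.2 (𝓕.surjective_fderiv_localMap hdom)), Filter.eventually_map]
    filter_upwards [hW'.mem_nhds hyW'] with y hy
    exact 𝓕.local_form_smul hα (hsub hy) (hrep y hy) (𝓕.surjective_fderiv_localMap (hsub hy))
  obtain ⟨A, -, hA⟩ := 𝓕.exists_fderiv_localMap hdom
  have hd : ∀ w : Fin (k + 1) → TangentSpace 𝓘(ℝ, E) x, (𝓕.d k α).1 x w =
      extDeriv b (g y₀) (fun j => A (𝓕.transDeriv i x (w j))) := by
    intro w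
    have h1 : extDeriv (chartRep x α.1) y₀ =
        (extDeriv b (g y₀)).compContinuousLinearMap (fderiv ℝ g y₀) := by
      rw [(Filter.eventuallyEq_of_mem (hW'.mem_nhds hyW') hrep).extDeriv_eq,
        extDeriv_pullback (r := ∞) hbd hgat minSmoothness_two_le]
    have hf : HasMFDerivAt 𝓘(ℝ, E) 𝓘(ℝ, F) (𝓕.f i)
        ((extChartAt 𝓘(ℝ, E) x).symm (extChartAt 𝓘(ℝ, E) x x)) (𝓕.transDeriv i _) :=
      (((𝓕.smooth_f i).contMDiffAt ((𝓕.isOpen_U i).mem_nhds (by rwa [hxs]))).mdifferentiableAt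
        (by simp)).hasMFDerivAt
    have h2 := HasMFDerivAt.comp x
      (hf.comp _ (mdiff_symm (mem_extChartAt_target x)).hasMFDerivAt)
      (mdiff_chart (mem_extChartAt_source x)).hasMFDerivAt
    have h3 : 𝓕.f i =ᶠ[𝓝 x]
        (𝓕.f i ∘ (extChartAt 𝓘(ℝ, E) x).symm) ∘ extChartAt 𝓘(ℝ, E) x :=
      Filter.eventuallyEq_of_mem (extChartAt_source_mem_nhds x) fun z hz =>
        congrArg (𝓕.f i) ((extChartAt 𝓘(ℝ, E) x).left_inv hz).symm
    have h4 := fun j => DFunLike.congr_fun (h2.congr_of_eventuallyEq h3).mfderiv (w j)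
    refine (congrArg (fun B : E [⋀^Fin (k + 1)]→L[ℝ] ℂ => B fun j =>
      mfderiv 𝓘(ℝ, E) 𝓘(ℝ, E) (extChartAt 𝓘(ℝ, E) x) x (w j)) h1).trans ?_
    refine congrArg (extDeriv b (g y₀)) (funext fun j => ?_)
    refine (hA _).trans (congrArg A ?_)
    exact (h4 j).symm
  obtain ⟨X, Y, hXY⟩ := extDeriv_smul_of_type hbd htype (fun j => A (𝓕.transDeriv i x (v j)))
  refine ⟨X, Y, fun c => ?_⟩
  rw [← hXY c]
  refine (hd fun j => 𝓕.lift c x (v j)).trans ?_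
  refine congrArg (extDeriv b (g y₀)) (funext fun j => ?_)
  rw [𝓕.transDeriv_lift c hx, A.map_smul]

/-- The exterior derivative of a basic form of type `(p, k - p)` has only parts of the types
`(p + 1, k - p)` and `(p, k + 1 - p)`. -/
lemma typeProj_d_eq_zero {p q : ℕ} (hp : p ≤ k) (hq : q ≤ k + 1) (hqp : q ≠ p)
    (hqp' : q ≠ p + 1) {α : 𝓕.basicForms k} (hα : α ∈ 𝓕.typeForms k p (k - p)) :
    𝓕.typeProj (k + 1) q (k + 1 - q) (𝓕.d k α) = 0 := by
  refine Subtype.ext (funext fun x => ?_)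
  ext v
  obtain ⟨X, Y, h⟩ := 𝓕.exists_scale_d_eq hα x v
  refine (𝓕.typeProj_apply_of_scale (𝓕.d k α)
    (a := fun r => if r = p + 1 then X else if r = p then Y else 0) (fun c => ?_) hq).trans ?_
  · rw [h]
    have h1 : ∀ r, c ^ r * (starRingEnd ℂ c) ^ (k + 1 - r) *
        (if r = p + 1 then X else if r = p then Y else 0) =
        (if r = p + 1 then c ^ r * (starRingEnd ℂ c) ^ (k + 1 - r) * X else 0) +
        (if r = p then c ^ r * (starRingEnd ℂ c) ^ (k + 1 - r) * Y else 0) := by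
      intro r
      split_ifs <;> first | omega | simp
    simp only [h1, Finset.sum_add_distrib]
    rw [Finset.sum_ite_eq', Finset.sum_ite_eq', if_pos (Finset.mem_range.2 (by omega)),
      if_pos (Finset.mem_range.2 (by omega)), show k + 1 - (p + 1) = k - p by omega,
      show k + 1 - p = k - p + 1 by omega]
  · rw [if_neg hqp', if_neg hqp]
    rfl

end TransverselyHolomorphicFoliation
-- From a differential with two components to a double complex
section TotalDifferential
universe u
variable {𝕜 : Type*} [Field 𝕜] {A : ℕ → Type u} [∀ k, AddCommGroup (A k)] [∀ k, Module 𝕜 (A k)]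
  {d del delbar : ∀ k, A k →ₗ[𝕜] A (k + 1)} {π : ∀ k, ℕ → A k →ₗ[𝕜] A k}

/-- A differential whose parts are of bidegree `(1, 0)` and `(0, 1)` defines a double complex. -/
theorem IsDoubleComplex.of_differential
    (hπ : ∀ k p q x, π k p (π k q x) = if p = q then π k p x else 0)
    (hlt : ∀ k p x, k < p → π k p x = 0)
    (hsum : ∀ k x, ∑ p ∈ Finset.range (k + 1), π k p x = x)
    (hdd : ∀ k x, d (k + 1) (d k x) = 0)
    (htype : ∀ k p q x, q ≠ p → q ≠ p + 1 → π (k + 1) q (d k (π k p x)) = 0)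
    (hdel : ∀ k x, del k x = ∑ p ∈ Finset.range (k + 1), π (k + 1) (p + 1) (d k (π k p x)))
    (hdelbar : ∀ k x, delbar k x = ∑ p ∈ Finset.range (k + 1), π (k + 1) p (d k (π k p x))) :
    IsDoubleComplex del delbar π ∧ ∀ k, d k = del k + delbar k := by
  -- Collapses a sum with one surviving index even when that index lies outside the range, where the
  -- term must vanish by itself.
  have hsingle : ∀ k p (B : Type u) [AddCommGroup B] (f : ℕ → B), (k < p → f p = 0) →
      ∑ q ∈ Finset.range (k + 1), (if q = p then f q else 0) = f p := by
    intro k p B _ f hf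
    rw [Finset.sum_ite_eq']
    split_ifs with h
    · rfl
    · exact (hf (by simpa using h)).symm
  have del_proj : ∀ k p x, del k (π k p x) = π (k + 1) (p + 1) (d k (π k p x)) := by
    intro k p x
    rw [hdel, ← hsingle k p _ (fun q => π (k + 1) (q + 1) (d k (π k q x)))
      fun h => by simp [hlt k p x h]]
    refine Finset.sum_congr rfl fun q _ => ?_
    rw [hπ]
    split_ifs <;> simp
  have delbar_proj : ∀ k p x, delbar k (π k p x) = π (k + 1) p (d k (π k p x)) := by
    intro k p x
    rw [hdelbar, ← hsingle k p _ (fun q => π (k + 1) q (d k (π k q x)))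
      fun h => by simp [hlt k p x h]]
    refine Finset.sum_congr rfl fun q _ => ?_
    rw [hπ]
    split_ifs <;> simp
  have proj_del : ∀ k p x, π (k + 1) (p + 1) (del k x) = π (k + 1) (p + 1) (d k (π k p x)) := by
    intro k p x
    rw [hdel, map_sum, ← hsingle k p _ (fun q => π (k + 1) (q + 1) (d k (π k q x)))
      fun h => by simp [hlt k p x h]]
    refine Finset.sum_congr rfl fun q _ => ?_
    rw [hπ]
    by_cases h : q = p
    · simp [h]
    · rw [if_neg (by omega), if_neg h]
  have proj_delbar : ∀ k p x, π (k + 1) p (delbar k x) = π (k + 1) p (d k (π k p x)) := by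
    intro k p x
    rw [hdelbar, map_sum, ← hsingle k p _ (fun q => π (k + 1) q (d k (π k q x)))
      fun h => by simp [hlt k p x h]]
    refine Finset.sum_congr rfl fun q _ => ?_
    rw [hπ]
    by_cases h : q = p
    · simp [h]
    · rw [if_neg (by omega), if_neg h]
  have h1 : ∀ k p x, del k (π k p x) = π (k + 1) (p + 1) (del k x) := fun k p x => by
    rw [del_proj, proj_del]
  have h2 : ∀ k p x, delbar k (π k p x) = π (k + 1) p (delbar k x) := fun k p x => by
    rw [delbar_proj, proj_delbar]
  have hd : ∀ k x, d k x = del k x + delbar k x := by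
    intro k x
    rw [hdel, hdelbar, ← Finset.sum_add_distrib]
    conv_lhs => rw [← hsum k x, map_sum]
    refine Finset.sum_congr rfl fun p hp => ?_
    have hp' := Finset.mem_range.1 hp
    conv_lhs => rw [← hsum (k + 1) (d k (π k p x))]
    rw [← Finset.sum_subset (s₁ := {p + 1, p}), Finset.sum_pair (by omega)]
    · intro q hq
      simp only [Finset.mem_insert, Finset.mem_singleton] at hq
      exact Finset.mem_range.2 (by omega)
    · intro q _ hq
      simp only [Finset.mem_insert, Finset.mem_singleton, not_or] at hq
      exact htype k p q x hq.2 hq.1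
  have hdd' : ∀ k x, del (k + 1) (del k x) + delbar (k + 1) (del k x) +
      (del (k + 1) (delbar k x) + delbar (k + 1) (delbar k x)) = 0 := by
    intro k x
    have := hdd k x
    rw [hd k, map_add, hd (k + 1), hd (k + 1)] at this
    exact this
  have h3 : ∀ k p q x, π (k + 2) q (del (k + 1) (del k (π k p x))) =
      if q = p + 2 then del (k + 1) (del k (π k p x)) else 0 := by
    intro k p q x
    rw [h1, h1, hπ]
    split_ifs with h
    · rw [h]
    · rfl
  have h4 : ∀ k p q x, π (k + 2) q (delbar (k + 1) (del k (π k p x))) =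
      if q = p + 1 then delbar (k + 1) (del k (π k p x)) else 0 := by
    intro k p q x
    rw [h1, h2, hπ]
    split_ifs with h
    · rw [h]
    · rfl
  have h5 : ∀ k p q x, π (k + 2) q (del (k + 1) (delbar k (π k p x))) =
      if q = p + 1 then del (k + 1) (delbar k (π k p x)) else 0 := by
    intro k p q x
    rw [h2, h1, hπ]
    split_ifs with h
    · rw [h]
    · rfl
  have h6 : ∀ k p q x, π (k + 2) q (delbar (k + 1) (delbar k (π k p x))) =
      if q = p then delbar (k + 1) (delbar k (π k p x)) else 0 := by
    intro k p q x
    rw [h2, h2, hπ]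
    split_ifs with h
    · rw [h]
    · rfl
  -- The part of index `q` of d² = 0 on a form of index `p`. Taking `q` to be `p + 2`, `p + 1` and
  -- `p` isolates ∂² = 0, the anticommutation and ∂̄² = 0.
  have hcomp : ∀ k p q x, (if q = p + 2 then del (k + 1) (del k (π k p x)) else 0) +
      (if q = p + 1 then delbar (k + 1) (del k (π k p x)) else 0) +
      ((if q = p + 1 then del (k + 1) (delbar k (π k p x)) else 0) +
      (if q = p then delbar (k + 1) (delbar k (π k p x)) else 0)) = 0 := by
    intro k p q x
    have := congrArg (π (k + 2) q) (hdd' k (π k p x))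
    rwa [map_add, map_add, map_add, map_zero, h3, h4, h5, h6] at this
  refine ⟨⟨hπ, hsum, h1, h2, fun k x => ?_, fun k x => ?_, fun k x => ?_⟩,
    fun k => LinearMap.ext (hd k)⟩
  · rw [← hsum k x, map_sum, map_sum]
    exact Finset.sum_eq_zero fun p _ => by simpa using hcomp k p (p + 2) x
  · rw [← hsum k x, map_sum, map_sum]
    exact Finset.sum_eq_zero fun p _ => by simpa using hcomp k p p x
  · rw [eq_neg_iff_add_eq_zero, ← hsum k x]
    simp only [map_sum]
    rw [← Finset.sum_add_distrib]
    exact Finset.sum_eq_zero fun p _ => by simpa using hcomp k p (p + 1) x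

namespace IsDoubleComplex
variable (h : IsDoubleComplex del delbar π)
include h

lemma proj_mem_imDeg_del {k : ℕ} (p : ℕ) {x : A k} (hx : x ∈ imDeg del k) :
    π k p x ∈ imDeg del k := by
  match k with
  | 0 =>
    have : x = 0 := hx
    rw [this, map_zero]
    exact Submodule.zero_mem _
  | k + 1 =>
    obtain ⟨y, rfl⟩ := hx
    rcases p with _ | p
    · rw [h.proj_zero_del]
      exact Submodule.zero_mem _
    · rw [← h.del_proj]
      exact ⟨_, rfl⟩

lemma proj_mem_imDeg_delbar {k : ℕ} (p : ℕ) {x : A k} (hx : x ∈ imDeg delbar k) :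
    π k p x ∈ imDeg delbar k := by
  match k with
  | 0 =>
    have : x = 0 := hx
    rw [this, map_zero]
    exact Submodule.zero_mem _
  | k + 1 =>
    obtain ⟨y, rfl⟩ := hx
    rw [← h.delbar_proj]
    exact ⟨_, rfl⟩

lemma proj_mem_imDegTwo {k : ℕ} (p : ℕ) {x : A k} (hx : x ∈ imDegTwo del delbar k) :
    π k p x ∈ imDegTwo del delbar k := by
  match k with
  | 0 | 1 =>
    have : x = 0 := hx
    rw [this, map_zero]
    exact Submodule.zero_mem _
  | k + 2 =>
    obtain ⟨y, rfl⟩ := hx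
    rw [LinearMap.comp_apply]
    rcases p with _ | p
    · rw [h.proj_zero_del]
      exact Submodule.zero_mem _
    · rw [← h.del_proj, ← h.delbar_proj]
      exact ⟨_, rfl⟩

lemma relRank_eq_sum_range {k : ℕ} {K N : Submodule 𝕜 (A k)} (hK : ∀ p, ∀ x ∈ K, π k p x ∈ K)
    (hN : ∀ p, ∀ x ∈ N, π k p x ∈ N) :
    relRank K N = ∑ p ∈ Finset.range (k + 1), relRank (LinearMap.range (π k p) ⊓ K) N := by
  rw [Finset.sum_range]
  refine relRank_eq_sum (fun p : Fin (k + 1) => π k p) (fun i j x => ?_) (fun x => ?_)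
    (fun i => hK i) fun i => hN i
  · rw [h.proj_proj]
    simp only [Fin.ext_iff]
  · rw [← Finset.sum_range (fun p => π k p x), h.sum_proj]

lemma relRank_bottChern_eq_sum (k : ℕ) :
    relRank (LinearMap.ker (del k) ⊓ LinearMap.ker (delbar k)) (imDegTwo del delbar k) =
      ∑ p ∈ Finset.range (k + 1), relRank (LinearMap.range (π k p) ⊓
        (LinearMap.ker (del k) ⊓ LinearMap.ker (delbar k))) (imDegTwo del delbar k) := by
  refine h.relRank_eq_sum_range (fun p x hx => ?_) fun p x hx => h.proj_mem_imDegTwo p hx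
  have h1 := LinearMap.mem_ker.1 hx.1
  have h2 := LinearMap.mem_ker.1 hx.2
  refine ⟨LinearMap.mem_ker.2 ?_, LinearMap.mem_ker.2 ?_⟩
  · rw [h.del_proj, h1, map_zero]
  · rw [h.delbar_proj, h2, map_zero]

lemma relRank_aeppli_eq_sum (k : ℕ) :
    relRank (LinearMap.ker (del (k + 1) ∘ₗ delbar k)) (imDeg del k ⊔ imDeg delbar k) =
      ∑ p ∈ Finset.range (k + 1), relRank (LinearMap.range (π k p) ⊓
        LinearMap.ker (del (k + 1) ∘ₗ delbar k)) (imDeg del k ⊔ imDeg delbar k) := by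
  refine h.relRank_eq_sum_range (fun p x hx => ?_) fun p x hx => ?_
  · rw [LinearMap.mem_ker, LinearMap.comp_apply] at hx ⊢
    rw [h.delbar_proj, h.del_proj, hx, map_zero]
  · obtain ⟨a, ha, b, hb, rfl⟩ := Submodule.mem_sup.1 hx
    rw [map_add]
    exact Submodule.add_mem_sup (h.proj_mem_imDeg_del p ha) (h.proj_mem_imDeg_delbar p hb)

end IsDoubleComplex
end TotalDifferential

/-! ### The basic Dolbeault double complex and its cohomologies -/

namespace TransverselyHolomorphicFoliation
variable {E : Type*} [NormedAddCommGroup E] [NormedSpace ℝ E]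
  {M : Type*} [TopologicalSpace M] [ChartedSpace E M]
  {F : Type*} [NormedAddCommGroup F] [NormedSpace ℂ F]
  {T : Type*} [TopologicalSpace T] [ChartedSpace F T] {ι : Type*}
  (𝓕 : TransverselyHolomorphicFoliation E M F T ι)
  [IsManifold 𝓘(ℝ, E) ∞ M] [IsManifold 𝓘(ℂ, F) ω T]
  [FiniteDimensional ℝ E] [FiniteDimensional ℂ F]

/-- Truncated subtraction makes `p + (k - p)` equal to `p`, which is not `k`, so the default value 0
of `typeProj` applies. -/
lemma typeProj_of_lt {k p : ℕ} (hp : k < p) (α : 𝓕.basicForms k) :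
    𝓕.typeProj k p (k - p) α = 0 := by
  rw [typeProj, if_neg (by omega), LinearMap.zero_apply]

/-- The basic Dolbeault double complex. -/
theorem isDoubleComplex :
    IsDoubleComplex 𝓕.del 𝓕.delbar (fun k p => 𝓕.typeProj k p (k - p)) ∧
      ∀ k, 𝓕.d k = 𝓕.del k + 𝓕.delbar k := by
  refine IsDoubleComplex.of_differential (d := 𝓕.d) ?_ (fun k p x hp => 𝓕.typeProj_of_lt hp x)
    (fun k x => 𝓕.sum_typeProj x) ?_ ?_ ?_ ?_
  · intro k p q x
    rcases lt_or_ge k q with hq | hq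
    · rw [𝓕.typeProj_of_lt hq, map_zero]
      split_ifs with h
      · rw [h, 𝓕.typeProj_of_lt hq]
      · rfl
    rcases lt_or_ge k p with hp | hp
    · rw [𝓕.typeProj_of_lt hp, if_neg (by omega)]
    · exact 𝓕.typeProj_typeProj hp hq x
  · exact fun k x => Subtype.ext (extDerivForm_extDerivForm x.2.1)
  · intro k p q x hqp hqp'
    rcases lt_or_ge k p with hp | hp
    · rw [𝓕.typeProj_of_lt hp, map_zero, map_zero]
    rcases lt_or_ge (k + 1) q with hq | hq
    · exact 𝓕.typeProj_of_lt hq _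
    · exact 𝓕.typeProj_d_eq_zero hp hq hqp hqp' (𝓕.typeProj_mem x hp)
  · intro k x
    rw [del, LinearMap.sum_apply, Finset.Nat.sum_antidiagonal_eq_sum_range_succ_mk]
    refine Finset.sum_congr rfl fun p hp => ?_
    simp only [LinearMap.comp_apply, Nat.add_sub_add_right]
  · intro k x
    rw [delbar, LinearMap.sum_apply, Finset.Nat.sum_antidiagonal_eq_sum_range_succ_mk]
    refine Finset.sum_congr rfl fun p hp => ?_
    have := Finset.mem_range.1 hp
    simp only [LinearMap.comp_apply, show k - p + 1 = k + 1 - p by omega]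

lemma imD_eq (k : ℕ) : 𝓕.imD k = imDeg (fun k => 𝓕.del k + 𝓕.delbar k) k := by
  cases k with
  | zero => rfl
  | succ k => exact congrArg LinearMap.range (𝓕.isDoubleComplex.2 k)

lemma imDel_eq (k : ℕ) : 𝓕.imDel k = imDeg 𝓕.del k := by
  cases k <;> rfl

lemma imDelbar_eq (k : ℕ) : 𝓕.imDelbar k = imDeg 𝓕.delbar k := by
  cases k <;> rfl

lemma imDelDelbar_eq (k : ℕ) : 𝓕.imDelDelbar k = imDegTwo 𝓕.del 𝓕.delbar k := by
  match k with
  | 0 | 1 | k + 2 => rfl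

lemma rank_basicCohomology (k : ℕ) : Module.rank ℂ (𝓕.BasicCohomology k) =
    relRank (LinearMap.ker (𝓕.del k + 𝓕.delbar k))
      (imDeg (fun k => 𝓕.del k + 𝓕.delbar k) k) := by
  rw [← 𝓕.imD_eq, ← 𝓕.isDoubleComplex.2]
  rfl

/-- The degree is a free variable `k` with an equation, here and in the next two lemmas, because
they are used for `q = k - p`, where `p + (k - p)` is not definitionally `k`. -/
lemma rank_dolbeaultCohomology {p q k : ℕ} (hk : p + q = k) :
    Module.rank ℂ (𝓕.DolbeaultCohomology p q) =
      relRank (LinearMap.range (𝓕.typeProj k p (k - p)) ⊓ LinearMap.ker (𝓕.delbar k))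
        (imDeg 𝓕.delbar k) := by
  subst hk
  rw [𝓕.range_typeProj (by omega), ← 𝓕.imDelbar_eq, Nat.add_sub_cancel_left]
  rfl

lemma rank_bottChernCohomology {p q k : ℕ} (hk : p + q = k) :
    Module.rank ℂ (𝓕.BottChernCohomology p q) =
      relRank (LinearMap.range (𝓕.typeProj k p (k - p)) ⊓
        (LinearMap.ker (𝓕.del k) ⊓ LinearMap.ker (𝓕.delbar k))) (imDegTwo 𝓕.del 𝓕.delbar k) := by
  subst hk
  rw [𝓕.range_typeProj (by omega), ← 𝓕.imDelDelbar_eq, Nat.add_sub_cancel_left]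
  rfl

lemma rank_aeppliCohomology {p q k : ℕ} (hk : p + q = k) :
    Module.rank ℂ (𝓕.AeppliCohomology p q) =
      relRank (LinearMap.range (𝓕.typeProj k p (k - p)) ⊓
        LinearMap.ker (𝓕.del (k + 1) ∘ₗ 𝓕.delbar k)) (imDeg 𝓕.del k ⊔ imDeg 𝓕.delbar k) := by
  subst hk
  rw [𝓕.range_typeProj (by omega), ← 𝓕.imDel_eq, ← 𝓕.imDelbar_eq, Nat.add_sub_cancel_left]
  rfl

lemma sum_rank_bottChern_add_aeppli (k : ℕ) :
    ∑ pq ∈ Finset.HasAntidiagonal.antidiagonal k,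
        (Module.rank ℂ (𝓕.BottChernCohomology pq.1 pq.2) +
          Module.rank ℂ (𝓕.AeppliCohomology pq.1 pq.2)) =
      relRank (LinearMap.ker (𝓕.del k) ⊓ LinearMap.ker (𝓕.delbar k))
        (imDegTwo 𝓕.del 𝓕.delbar k) +
      relRank (LinearMap.ker (𝓕.del (k + 1) ∘ₗ 𝓕.delbar k))
        (imDeg 𝓕.del k ⊔ imDeg 𝓕.delbar k) := by
  rw [𝓕.isDoubleComplex.1.relRank_bottChern_eq_sum, 𝓕.isDoubleComplex.1.relRank_aeppli_eq_sum,
    ← Finset.sum_add_distrib, Finset.Nat.sum_antidiagonal_eq_sum_range_succ_mk]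
  refine Finset.sum_congr rfl fun p hp => ?_
  have hp' := Finset.mem_range.1 hp
  have hk : p + (k - p) = k := by omega
  exact congrArg₂ (· + ·) (𝓕.rank_bottChernCohomology hk) (𝓕.rank_aeppliCohomology hk)

lemma satisfiesDelDelbarLemma_iff : 𝓕.SatisfiesDelDelbarLemma ↔
    ∀ k, LinearMap.ker (𝓕.del k) ⊓ LinearMap.ker (𝓕.delbar k) ⊓
      imDeg (fun k => 𝓕.del k + 𝓕.delbar k) k = imDegTwo 𝓕.del 𝓕.delbar k := by
  refine forall_congr' fun k => ?_
  rw [← 𝓕.imD_eq, ← 𝓕.imDelDelbar_eq]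

end TransverselyHolomorphicFoliation
end BasicForms
end

/-! ### The theorem for basic cohomology -/

theorem mainTheorem1 {n r : ℕ}
    {M : Type*} [TopologicalSpace M] [T2Space M] [SecondCountableTopology M]
    [ChartedSpace (EuclideanSpace ℝ (Fin n)) M] [IsManifold 𝓘(ℝ, EuclideanSpace ℝ (Fin n)) ∞ M]
    {T : Type*} [TopologicalSpace T]
    [ChartedSpace (EuclideanSpace ℂ (Fin r)) T] [IsManifold 𝓘(ℂ, EuclideanSpace ℂ (Fin r)) ω T]
    {ι : Type*}
    (𝓕 : BasicForms.TransverselyHolomorphicFoliation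
      (EuclideanSpace ℝ (Fin n)) M (EuclideanSpace ℂ (Fin r)) T ι)
    (hfin : ∀ p q : ℕ, FiniteDimensional ℂ (𝓕.DolbeaultCohomology p q)) :
    (∀ k : ℕ, 2 * Module.rank ℂ (𝓕.BasicCohomology k) ≤
      ∑ pq ∈ Finset.HasAntidiagonal.antidiagonal k,
        (Module.rank ℂ (𝓕.BottChernCohomology pq.1 pq.2) +
          Module.rank ℂ (𝓕.AeppliCohomology pq.1 pq.2))) ∧
    ((∀ k : ℕ, ∑ pq ∈ Finset.HasAntidiagonal.antidiagonal k,
        (Module.rank ℂ (𝓕.BottChernCohomology pq.1 pq.2) +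
          Module.rank ℂ (𝓕.AeppliCohomology pq.1 pq.2)) =
        2 * Module.rank ℂ (𝓕.BasicCohomology k)) ↔
      𝓕.SatisfiesDelDelbarLemma) := by
  have h := 𝓕.isDoubleComplex.1
  have hlt : ∀ k, BasicForms.relRank (LinearMap.ker (𝓕.del k + 𝓕.delbar k))
      (BasicForms.imDeg (fun k => 𝓕.del k + 𝓕.delbar k) k) < Cardinal.aleph0 := by
    refine fun k => h.relRank_ker_lt_aleph0 k fun p hp => ?_
    rw [← 𝓕.rank_dolbeaultCohomology (Nat.add_sub_of_le hp)]
    have := hfin p (k - p)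
    exact Module.rank_lt_aleph0 ℂ _
  simp only [𝓕.sum_rank_bottChern_add_aeppli, 𝓕.rank_basicCohomology,
    𝓕.satisfiesDelDelbarLemma_iff]
  exact ⟨h.two_mul_relRank_le, h.inf_eq_of_relRank_add_eq hlt, h.relRank_add_eq_of_inf_eq⟩
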